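/- For a twice-differentiable $f:\mathbb R^d\to\mathbb R$ with $\int e^{-f}=1$ and a step size $h>0$, MALA is the Markov chain which from $x$ proposes $y=x-h\nabla f(x)+\sqrt{2h}\,g$, $g\sim\mathcal N(0,\mathbf I)$, moves to $y$ with probability \[\min\left(1,\frac{\exp\left(-f(y)-\frac{1}{4h}\|x-(y-h\nabla f(y))\|_2^2\right)}{\exp\left(-f(x)-\frac{1}{4h}\|y-(x-h\nabla f(x))\|_2^2\right)}\right),\] and otherwise stays at $x$. A probability measure $\rho$ is a $\beta$-warm start for $\pi$ if $\frac{d\rho}{d\pi}\le\beta$, and $\|\pi-\rho\|_{\mathrm{TV}}=\sup_A(\pi(A)-\rho(A))$. Theorem. For every constant $C$ there are a constant $c>0$ and $d_0\in\mathbb N$ such that for every $d\ge d_0$, every $\kappa$ with $10\le\kappa\le C d^4$ and every step size $h>0$, there are a probability density $\pi=e^{-f}$ on $\mathbb R^d$ with $f$ twice continuously differentiable and all eigenvalues of $\nabla^2 f(x)$ in $[1,\kappa]$ for all $x$, and an $\exp(d)$-warm start $\rho$ for $\pi$, such that MALA with step size $h$ started from $\rho$ needs at least $c\,\frac{\kappa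 d}{\log^2 d}$ iterations to reach total variation distance $e^{-1}$ to $\pi$: if the law $\rho_T$ of its $T$-th iterate satisfies $\|\pi-\rho_T\|_{\mathrm{TV}}\le e^{-1}$, then $T\ge c\,\frac{\kappa d}{\log^2 d}$. -/

import Mathlib

open MeasureTheory ProbabilityTheory

noncomputable section

namespace MALA

/-- `ℝ^d` with the Euclidean norm. -/
abbrev Vec (d : ℕ) : Type := EuclideanSpace ℝ (Fin d)

variable {d : ℕ}

/-- `f` is twice continuously differentiable and `I ⪯ ∇² f(x) ⪯ κ I` at every point `x`, that is,
all eigenvalues of the Hessian lie in `[1, κ]`. -/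
def HessianBetween (κ : ℝ) (f : Vec d → ℝ) : Prop :=
  ContDiff ℝ 2 f ∧
    ∀ x v : Vec d, ‖v‖ ^ 2 ≤ fderiv ℝ (fderiv ℝ f) x v v ∧
      fderiv ℝ (fderiv ℝ f) x v v ≤ κ * ‖v‖ ^ 2

/-- The measure on `ℝ^d` with Lebesgue density `exp (-f)`. -/
def target (f : Vec d → ℝ) : Measure (Vec d) :=
  (volume : Measure (Vec d)).withDensity fun x => ENNReal.ofReal (Real.exp (-f x))

/-- The mean `x - h ∇f(x)` of the proposal made at `x`. -/
def drift (f : Vec d → ℝ) (h : ℝ) (x : Vec d) : Vec d := x - h • gradient f x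

/-- The proposal `N(x - h ∇f(x), 2 h I)` at `x`: the law of `x - h ∇f(x) + √(2h) g` for a standard
Gaussian vector `g`. -/
def proposal (f : Vec d → ℝ) (h : ℝ) (x : Vec d) : Measure (Vec d) :=
  (stdGaussian (Vec d)).map fun g => drift f h x + Real.sqrt (2 * h) • g

/-- The Metropolis acceptance probability of a proposed move from `x` to `y`. -/
def acceptProb (f : Vec d → ℝ) (h : ℝ) (x y : Vec d) : ℝ :=
  min 1 (Real.exp (-f y - ‖x - drift f h y‖ ^ 2 / (4 * h)) /
    Real.exp (-f x - ‖y - drift f h x‖ ^ 2 / (4 * h)))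

/-- One MALA step from `x`: draw `y` from the proposal, move to `y` with probability
`acceptProb f h x y`, and otherwise stay at `x`. -/
def step (f : Vec d → ℝ) (h : ℝ) (x : Vec d) : Measure (Vec d) :=
  (proposal f h x).withDensity (fun y => ENNReal.ofReal (acceptProb f h x y)) +
    (1 - ∫⁻ y, ENNReal.ofReal (acceptProb f h x y) ∂(proposal f h x)) • Measure.dirac x

theorem measurable_drift (f : Vec d → ℝ) (h : ℝ) : Measurable (drift f h) := by
  have hg : Measurable (gradient f) := by
    unfold gradient
    exact (InnerProductSpace.toDual ℝ (Vec d)).symm.continuous.measurable.comp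
      (measurable_fderiv ℝ f)
  unfold drift
  fun_prop

theorem measurable_acceptProb {f : Vec d → ℝ} (hf : Measurable f) (h : ℝ) :
    Measurable fun p : Vec d × Vec d => ENNReal.ofReal (acceptProb f h p.1 p.2) := by
  have hd := measurable_drift f h
  unfold acceptProb
  fun_prop

theorem measurable_step {f : Vec d → ℝ} (hf : Measurable f) (h : ℝ) : Measurable (step f h) := by
  have hm : Measurable fun p : Vec d × Vec d => drift f h p.1 + Real.sqrt (2 * h) • p.2 := by
    have hd := measurable_drift f h
    fun_prop
  have ha := measurable_acceptProb hf h
  have key : ∀ s : Set (Vec d), MeasurableSet s → Measurable fun x =>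
      ∫⁻ y in s, ENNReal.ofReal (acceptProb f h x y) ∂(proposal f h x) := by
    intro s hs
    have hmx : ∀ x, Measurable fun g : Vec d => drift f h x + Real.sqrt (2 * h) • g :=
      fun x => hm.comp measurable_prodMk_left
    have hax : ∀ x, Measurable fun y => ENNReal.ofReal (acceptProb f h x y) :=
      fun x => ha.comp measurable_prodMk_left
    have e : (fun x => ∫⁻ y in s, ENNReal.ofReal (acceptProb f h x y) ∂(proposal f h x)) =
        fun x => ∫⁻ g, s.indicator (fun y => ENNReal.ofReal (acceptProb f h x y))
          (drift f h x + Real.sqrt (2 * h) • g) ∂(stdGaussian (Vec d)) := by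
      funext x
      rw [← lintegral_indicator hs, proposal, lintegral_map ((hax x).indicator hs) (hmx x)]
    rw [e]
    have hi : Measurable fun p : Vec d × Vec d =>
        (Prod.snd ⁻¹' s).indicator (fun q : Vec d × Vec d =>
          ENNReal.ofReal (acceptProb f h q.1 q.2)) p := ha.indicator (measurable_snd hs)
    have hc := hi.comp (measurable_fst.prodMk hm)
    exact hc.lintegral_prod_right'
  refine Measure.measurable_of_measurable_coe _ fun s hs => ?_
  have h1 := key s hs
  have h2 := key Set.univ MeasurableSet.univ
  simp only [Measure.restrict_univ] at h2
  have h3 : Measurable fun x : Vec d => Measure.dirac x s :=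
    (Measure.measurable_coe hs).comp Measure.measurable_dirac
  simp only [step, Measure.add_apply, Measure.smul_apply, smul_eq_mul, withDensity_apply _ hs]
  exact h1.add ((measurable_const.sub h2).mul h3)

/-- The MALA transition kernel with step size `h` for the target density `exp (-f)`. -/
def kernel (f : Vec d → ℝ) (hf : Measurable f) (h : ℝ) : Kernel (Vec d) (Vec d) :=
  ⟨step f h, measurable_step hf h⟩

/-- The law of the MALA iterate after the given number of iterations, started from `ρ`. -/
def law (f : Vec d → ℝ) (hf : Measurable f) (h : ℝ) (ρ : Measure (Vec d)) : ℕ → Measure (Vec d)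
  | 0 => ρ
  | T + 1 => (law f hf h ρ T).bind (kernel f hf h)

/-- `ρ` is a `β`-warm start for `π`: a probability measure whose density with respect to `π` is at
most `β`, i.e. `ρ(A) ≤ β π(A)` for every `A`. -/
def IsWarm (β : ℝ) (π ρ : Measure (Vec d)) : Prop :=
  IsProbabilityMeasure ρ ∧ ρ ≤ ENNReal.ofReal β • π

/-- Total variation distance of probability measures, `sup_A (π(A) - ρ(A))`. -/
def tvDist (π ρ : Measure (Vec d)) : ℝ :=
  ⨆ A : {A : Set (Vec d) // MeasurableSet A}, (π.real A - ρ.real A)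

theorem HessianBetween.measurable {κ : ℝ} {f : Vec d → ℝ} (hf : HessianBetween κ f) :
    Measurable f := hf.1.continuous.measurable

end MALA

end

noncomputable section

namespace MALA

open scoped ENNReal

variable {d : ℕ}

/-! The target may depend on the step size, so the proof splits the range of `h` into three regimes,
always with a separable potential, and with `π` conditioned on a box (or slab) as warm start.

Small steps, `h` at most of order `log² d / (κ d)`: the target is the standard Gaussian. The second
moment of one coordinate grows by at most `2h` per step (`lintegral_sq_step_le`), so a start
concentrated in that coordinate needs order `1 / h` steps to spread (`exists_warm_stdPot`).

For larger steps the obstacle is rejection. If the acceptance rate is at most `a` on a set `S`, the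
chain started from `π` conditioned on `S` has mass at most `T a` outside `S` after `T` steps, while
`π` has constant mass there (`le_of_tvDist_cond_le`). On a box the acceptance rate is at most a
product of one-dimensional Gaussian integrals (`acceptRate_sep_le`). An `exp d` warm start allows
the box to have mass as small as `exp (-d)`, a constant factor per coordinate. An acceptance rate of
`d⁻⁵` suffices, because `κ d` is at most of order `d⁵`.

Large steps, `h ≥ 1/10`: near the mode of the standard Gaussian each coordinate contributes a factor
at most `(1 + h²)^(-1/4)`, so acceptance is exponentially unlikely in `d`.

Intermediate steps: about `d / log d` coordinates receive a potential whose curvature drops away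
from `0` at the spatial scale `√h` of the proposal noise. The log acceptance ratio contains the
trapezoidal error of the potential, which the decreasing curvature makes negative, of order `τ = min
κ (1/h) * h`. Each such coordinate thus contributes a factor `exp (-c τ)`. Confining it near `0`
costs a mass factor no smaller than `1/d`, which limits their number to order `d / log d`; this is
one logarithm, and the exponent `5 log d` needed for `d⁻⁵` is the other. -/

theorem lintegral_pi_prod {n : ℕ} (μ : Fin n → Measure ℝ) [∀ i, SigmaFinite (μ i)]
    (F : Fin n → ℝ → ℝ≥0∞) (hF : ∀ i, Measurable (F i)) :
    ∫⁻ x, ∏ i, F i (x i) ∂(Measure.pi μ) = ∏ i, ∫⁻ t, F i t ∂(μ i) := by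
  induction n with
  | zero => simp
  | succ n ih =>
    rw [← ((measurePreserving_piFinSuccAbove μ 0).symm).lintegral_comp (by fun_prop)]
    simp_rw [MeasurableEquiv.piFinSuccAbove_symm_apply, Fin.insertNthEquiv,
      Fin.prod_univ_succ, Equiv.coe_fn_mk, Fin.insertNth_zero]
    simp only [Fin.zero_succAbove, cast_eq, Fin.cons_zero, Fin.cons_succ]
    rw [lintegral_prod_mul (f := F 0)
      (g := fun x : Fin n → ℝ => ∏ i : Fin n, F i.succ (x i)) (hF 0).aemeasurable
      (Finset.measurable_prod _ fun i _ => (hF _).comp (measurable_pi_apply i)).aemeasurable,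
      ih (fun i => μ i.succ) (fun i => F i.succ) fun i => hF _]

/-! ### Separable potentials: derivatives, Hessian bounds and masses of boxes -/

/-- The separable function `x ↦ ∑ i, φ i (x i)`. -/
def sep {d : ℕ} (φ : Fin d → ℝ → ℝ) (x : Vec d) : ℝ := ∑ i, φ i (x i)


theorem contDiff_sep {φ : Fin d → ℝ → ℝ} (hφ : ∀ i, ContDiff ℝ 2 (φ i)) :
    ContDiff ℝ 2 (sep φ) := by
  unfold sep
  refine ContDiff.sum fun i _ => (hφ i).comp ?_
  exact (EuclideanSpace.proj (𝕜 := ℝ) i).contDiff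

theorem hasFDerivAt_comp_coord {g : ℝ → ℝ} (hg : Differentiable ℝ g) (i : Fin d) (x : Vec d) :
    HasFDerivAt (fun x : Vec d => g (x i))
      (deriv g (x i) • (EuclideanSpace.proj (𝕜 := ℝ) i : Vec d →L[ℝ] ℝ)) x :=
  HasDerivAt.comp_hasFDerivAt (h₂ := g) x (hg (x i)).hasDerivAt
    (EuclideanSpace.proj (𝕜 := ℝ) i : Vec d →L[ℝ] ℝ).hasFDerivAt

theorem fderiv_sep {φ : Fin d → ℝ → ℝ} (hφ : ∀ i, Differentiable ℝ (φ i)) (x : Vec d) :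
    fderiv ℝ (sep φ) x =
      ∑ i, deriv (φ i) (x i) • (EuclideanSpace.proj (𝕜 := ℝ) i : Vec d →L[ℝ] ℝ) := by
  have : HasFDerivAt (sep φ)
      (∑ i, deriv (φ i) (x i) • (EuclideanSpace.proj (𝕜 := ℝ) i : Vec d →L[ℝ] ℝ)) x := by
    unfold sep
    exact HasFDerivAt.fun_sum fun i _ => hasFDerivAt_comp_coord (hφ i) i x
  exact this.fderiv

theorem gradient_sep {φ : Fin d → ℝ → ℝ} (hφ : ∀ i, Differentiable ℝ (φ i)) (x : Vec d)
    (i : Fin d) : (gradient (sep φ) x) i = deriv (φ i) (x i) := by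
  have h : inner ℝ (gradient (sep φ) x) (EuclideanSpace.single i (1 : ℝ)) =
      fderiv ℝ (sep φ) x (EuclideanSpace.single i (1 : ℝ)) := by
    unfold gradient
    exact InnerProductSpace.toDual_symm_apply
  rw [fderiv_sep hφ, EuclideanSpace.inner_single_right] at h
  simpa using h

theorem fderiv_fderiv_sep {φ : Fin d → ℝ → ℝ} (hφ : ∀ i, ContDiff ℝ 2 (φ i)) (x v : Vec d) :
    fderiv ℝ (fderiv ℝ (sep φ)) x v v = ∑ i, deriv (deriv (φ i)) (x i) * v i ^ 2 := by
  have h1 : fderiv ℝ (sep φ) = fun x =>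
      ∑ i, deriv (φ i) (x i) • (EuclideanSpace.proj (𝕜 := ℝ) i : Vec d →L[ℝ] ℝ) :=
    funext fun x => fderiv_sep (fun i => (hφ i).differentiable (by norm_num)) x
  have hd : ∀ i, Differentiable ℝ (deriv (φ i)) := fun i =>
    ((contDiff_succ_iff_deriv (n := 1)).1 (hφ i)).2.2.differentiable (by norm_num)
  have h2 : HasFDerivAt (fderiv ℝ (sep φ))
      (∑ i, (deriv (deriv (φ i)) (x i) • (EuclideanSpace.proj (𝕜 := ℝ) i : Vec d →L[ℝ] ℝ)).smulRight
        (EuclideanSpace.proj (𝕜 := ℝ) i : Vec d →L[ℝ] ℝ)) x := by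
    rw [h1]
    refine HasFDerivAt.fun_sum fun i _ => ?_
    exact (hasFDerivAt_comp_coord (hd i) i x).smul_const
      (EuclideanSpace.proj (𝕜 := ℝ) i : Vec d →L[ℝ] ℝ)
  rw [h2.fderiv]
  simp [pow_two, mul_assoc]

theorem hessianBetween_sep {φ : Fin d → ℝ → ℝ} {κ : ℝ} (hφ : ∀ i, ContDiff ℝ 2 (φ i))
    (h1 : ∀ i t, 1 ≤ deriv (deriv (φ i)) t) (h2 : ∀ i t, deriv (deriv (φ i)) t ≤ κ) :
    HessianBetween κ (sep φ) := by
  refine ⟨contDiff_sep hφ, fun x v => ?_⟩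
  rw [fderiv_fderiv_sep hφ, EuclideanSpace.real_norm_sq_eq, Finset.mul_sum]
  exact ⟨Finset.sum_le_sum fun i _ => le_mul_of_one_le_left (sq_nonneg _) (h1 i _),
    Finset.sum_le_sum fun i _ => mul_le_mul_of_nonneg_right (h2 i _) (sq_nonneg _)⟩

/-- The box `{x | ∀ i, x i ∈ S i}`. -/
def box (S : Fin d → Set ℝ) : Set (Vec d) := {x | ∀ i, x i ∈ S i}

theorem measurableSet_box {S : Fin d → Set ℝ} (hS : ∀ i, MeasurableSet (S i)) :
    MeasurableSet (box S) := by
  have : box S = ⋂ i, (fun x : Vec d => x i) ⁻¹' S i := by ext; simp [box]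
  rw [this]
  exact MeasurableSet.iInter fun i => (by fun_prop : Measurable fun x : Vec d => x i) (hS i)

/-- The measure on `ℝ` with Lebesgue density `exp (-φ)`. -/
def target1 (φ : ℝ → ℝ) : Measure ℝ :=
  (volume : Measure ℝ).withDensity fun t => ENNReal.ofReal (Real.exp (-φ t))

theorem target_box {φ : Fin d → ℝ → ℝ} (hφ : ∀ i, Measurable (φ i)) {S : Fin d → Set ℝ}
    (hS : ∀ i, MeasurableSet (S i)) : target (sep φ) (box S) = ∏ i, target1 (φ i) (S i) := by
  have hprod : ∀ x : Fin d → ℝ, (box S).indicator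
      (fun x => ENNReal.ofReal (Real.exp (-sep φ x))) (WithLp.toLp 2 x) =
      ∏ i, (S i).indicator (fun t => ENNReal.ofReal (Real.exp (-φ i t))) (x i) := by
    intro x
    by_cases hx : WithLp.toLp 2 x ∈ box S
    · rw [Set.indicator_of_mem hx, sep, ← Finset.sum_neg_distrib, Real.exp_sum,
        ENNReal.ofReal_prod_of_nonneg fun i _ => (Real.exp_pos _).le]
      exact Finset.prod_congr rfl fun i _ => by rw [Set.indicator_of_mem (hx i)]
    · rw [Set.indicator_of_notMem hx]
      obtain ⟨i, hi⟩ : ∃ i, x i ∉ S i := by simpa [box] using hx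
      exact (Finset.prod_eq_zero (Finset.mem_univ i) (Set.indicator_of_notMem hi _)).symm
  have hF : ∀ i, Measurable fun t => (S i).indicator
      (fun t => ENNReal.ofReal (Real.exp (-φ i t))) t := fun i =>
    Measurable.indicator (by have := hφ i; fun_prop) (hS i)
  rw [target, withDensity_apply _ (measurableSet_box hS),
    ← lintegral_indicator (measurableSet_box hS),
    ← (PiLp.volume_preserving_toLp (Fin d)).lintegral_comp_emb
      (MeasurableEquiv.toLp 2 (Fin d → ℝ)).measurableEmbedding]
  simp_rw [hprod]
  rw [volume_pi, lintegral_pi_prod _ _ hF]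
  refine Finset.prod_congr rfl fun i _ => ?_
  rw [target1, withDensity_apply _ (hS i), lintegral_indicator (hS i)]

theorem isProbabilityMeasure_target_sep {φ : Fin d → ℝ → ℝ} (hφ : ∀ i, Measurable (φ i))
    [∀ i, IsProbabilityMeasure (target1 (φ i))] : IsProbabilityMeasure (target (sep φ)) := by
  constructor
  have := target_box hφ (S := fun _ => Set.univ) fun i => MeasurableSet.univ
  simpa [box] using this

theorem target_preimage {φ : Fin d → ℝ → ℝ} (hφ : ∀ i, Measurable (φ i))
    [∀ i, IsProbabilityMeasure (target1 (φ i))] (i : Fin d) {s : Set ℝ} (hs : MeasurableSet s) :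
    target (sep φ) {x | x i ∈ s} = target1 (φ i) s := by
  classical
  have := target_box hφ (S := fun j => if j = i then s else Set.univ) fun j => by
    split_ifs <;> simp [hs]
  have hb : box (fun j => if j = i then s else Set.univ) = {x : Vec d | x i ∈ s} := by
    ext x
    simp only [box, Set.mem_ofPred_eq]
    refine ⟨fun h => by simpa using h i, fun h j => ?_⟩
    split_ifs with hj
    · rwa [hj]
    · trivial
  rw [hb] at this
  rw [this, Finset.prod_eq_single i]
  · simp
  · intro j _ hj; simp [hj]
  · simp

/-! ### Acceptance probabilities for separable potentials -/

/-- The logarithm of the Metropolis acceptance ratio of a move from `a` to `b` for the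
one-dimensional target `exp (-φ)`. -/
def logRatio (φ : ℝ → ℝ) (h a b : ℝ) : ℝ :=
  φ a - φ b + ((b - (a - h * deriv φ a)) ^ 2 - (a - (b - h * deriv φ b)) ^ 2) / (4 * h)

theorem drift_sep {φ : Fin d → ℝ → ℝ} (hφ : ∀ i, Differentiable ℝ (φ i)) (h : ℝ) (x : Vec d)
    (i : Fin d) : (drift (sep φ) h x) i = x i - h * deriv (φ i) (x i) := by
  simp [drift, gradient_sep hφ]

theorem acceptProb_sep {φ : Fin d → ℝ → ℝ} (hφ : ∀ i, Differentiable ℝ (φ i)) (h : ℝ)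
    (x y : Vec d) :
    acceptProb (sep φ) h x y = min 1 (Real.exp (∑ i, logRatio (φ i) h (x i) (y i))) := by
  rw [acceptProb, ← Real.exp_sub]
  congr 2
  simp only [EuclideanSpace.real_norm_sq_eq, PiLp.sub_apply, drift_sep hφ, sep, logRatio,
    Finset.sum_add_distrib, Finset.sum_sub_distrib, ← Finset.sum_div]
  ring

theorem acceptProb_le_one (f : Vec d → ℝ) (h : ℝ) (x y : Vec d) : acceptProb f h x y ≤ 1 :=
  min_le_left _ _

theorem acceptProb_nonneg (f : Vec d → ℝ) (h : ℝ) (x y : Vec d) : 0 ≤ acceptProb f h x y :=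
  le_min zero_le_one (by positivity)

/-- The probability that the move proposed at `x` is accepted. -/
def acceptRate (f : Vec d → ℝ) (h : ℝ) (x : Vec d) : ℝ≥0∞ :=
  ∫⁻ y, ENNReal.ofReal (acceptProb f h x y) ∂(proposal f h x)

theorem measurable_proposalMap (f : Vec d → ℝ) (h : ℝ) (x : Vec d) :
    Measurable fun g : Vec d => drift f h x + Real.sqrt (2 * h) • g := by fun_prop

theorem measurable_acceptProb_right {f : Vec d → ℝ} (hf : Measurable f) (h : ℝ) (x : Vec d) :
    Measurable fun y => ENNReal.ofReal (acceptProb f h x y) :=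
  (measurable_acceptProb hf h).comp measurable_prodMk_left

instance (f : Vec d → ℝ) (h : ℝ) (x : Vec d) : IsProbabilityMeasure (proposal f h x) :=
  Measure.isProbabilityMeasure_map (measurable_proposalMap f h x).aemeasurable

theorem acceptRate_le_one (f : Vec d → ℝ) (h : ℝ) (x : Vec d) : acceptRate f h x ≤ 1 := by
  calc acceptRate f h x ≤ ∫⁻ _, 1 ∂(proposal f h x) :=
        lintegral_mono fun y => by simpa using acceptProb_le_one f h x y
    _ = 1 := by simp

/-- Replacing `min 1 r` by `r` makes the integrand a product over coordinates, and the noise is a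
product measure. This loses nothing essential when the typical ratio is small. -/
theorem acceptRate_sep_le {φ : Fin d → ℝ → ℝ} (hφ : ∀ i, ContDiff ℝ 2 (φ i)) (h : ℝ)
    (x : Vec d) : acceptRate (sep φ) h x ≤
      ∏ i, ∫⁻ g, ENNReal.ofReal (Real.exp (logRatio (φ i) h (x i)
        (x i - h * deriv (φ i) (x i) + Real.sqrt (2 * h) * g))) ∂(gaussianReal 0 1) := by
  have hd : ∀ i, Differentiable ℝ (φ i) := fun i => (hφ i).differentiable (by norm_num)
  have hm : Measurable (sep φ) := (contDiff_sep hφ).continuous.measurable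
  rw [acceptRate, proposal, lintegral_map (measurable_acceptProb_right hm h x)
    (measurable_proposalMap _ h x), ← map_pi_eq_stdGaussian,
    lintegral_map (f := fun g => ENNReal.ofReal
      (acceptProb (sep φ) h x (drift (sep φ) h x + Real.sqrt (2 * h) • g)))
      ((measurable_acceptProb_right hm h x).comp (measurable_proposalMap _ h x))
      (by fun_prop), ← lintegral_pi_prod]
  · refine lintegral_mono fun g => ?_
    simp only
    rw [← ENNReal.ofReal_prod_of_nonneg fun i _ => (Real.exp_pos _).le, ← Real.exp_sum,
      acceptProb_sep hd]
    refine ENNReal.ofReal_le_ofReal ((min_le_right _ _).trans_eq ?_)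
    simp [drift_sep hd]
  · intro i
    have h1 := (hφ i).continuous.measurable
    have h2 := measurable_deriv (φ i)
    unfold logRatio
    fun_prop

/-! ### One step of the chain and escape from a bottleneck -/

theorem step_apply (f : Vec d → ℝ) (h : ℝ) (x : Vec d) {s : Set (Vec d)} (hs : MeasurableSet s) :
    step f h x s = ∫⁻ y in s, ENNReal.ofReal (acceptProb f h x y) ∂(proposal f h x) +
      (1 - acceptRate f h x) * Measure.dirac x s := by
  simp [step, acceptRate, withDensity_apply _ hs]

theorem step_univ (f : Vec d → ℝ) (h : ℝ) (x : Vec d) : step f h x Set.univ = 1 := by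
  rw [step_apply f h x MeasurableSet.univ, Measure.restrict_univ]
  simpa [acceptRate] using add_tsub_cancel_of_le (acceptRate_le_one f h x)

theorem step_le {f : Vec d → ℝ} {h : ℝ} (x : Vec d) {s : Set (Vec d)} (hs : MeasurableSet s)
    (hx : x ∉ s) : step f h x s ≤ acceptRate f h x := by
  rw [step_apply f h x hs, Measure.dirac_apply' _ hs]
  simpa [hx, acceptRate] using
    setLIntegral_le_lintegral s fun y => ENNReal.ofReal (acceptProb f h x y)

theorem isProbabilityMeasure_law (f : Vec d → ℝ) (hf : Measurable f) (h : ℝ)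
    (ρ : Measure (Vec d)) [IsProbabilityMeasure ρ] (T : ℕ) :
    IsProbabilityMeasure (law f hf h ρ T) := by
  induction T with
  | zero => simpa [law]
  | succ T ih =>
    constructor
    rw [law, Measure.bind_apply MeasurableSet.univ (Kernel.aemeasurable _)]
    have : ∀ x, kernel f hf h x Set.univ = 1 := step_univ f h
    simp [this]

/-- Leaving `S` requires an accepted move, so each step adds at most `a` to the mass outside; mass
already outside is simply counted in full. -/
theorem law_compl_le (f : Vec d → ℝ) (hf : Measurable f) (h : ℝ) (ρ : Measure (Vec d))
    [IsProbabilityMeasure ρ] {S : Set (Vec d)} (hS : MeasurableSet S) (hρ : ρ Sᶜ = 0) {a : ℝ≥0∞}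
    (ha : ∀ x ∈ S, acceptRate f h x ≤ a) (T : ℕ) : law f hf h ρ T Sᶜ ≤ T * a := by
  induction T with
  | zero => simp [law, hρ]
  | succ T ih =>
    have := isProbabilityMeasure_law f hf h ρ T
    rw [law, Measure.bind_apply hS.compl (Kernel.aemeasurable _)]
    calc ∫⁻ x, kernel f hf h x Sᶜ ∂(law f hf h ρ T)
        ≤ ∫⁻ x, (Sᶜ.indicator 1 x + a) ∂(law f hf h ρ T) := by
          refine lintegral_mono fun x => ?_
          change step f h x Sᶜ ≤ _
          by_cases hx : x ∈ S
          · exact ((step_le x hS.compl (by simpa using hx)).trans (ha x hx)).trans le_add_self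
          · calc step f h x Sᶜ ≤ step f h x Set.univ := measure_mono (Set.subset_univ _)
              _ = 1 := step_univ f h x
              _ ≤ _ := by simp [hx]
      _ = law f hf h ρ T Sᶜ + a := by
          rw [lintegral_add_right _ measurable_const, lintegral_indicator_one hS.compl]
          simp
      _ ≤ T * a + a := by gcongr
      _ = (T + 1 : ℕ) * a := by push_cast; ring

theorem sub_le_tvDist (π ρ : Measure (Vec d)) [IsProbabilityMeasure π] {A : Set (Vec d)}
    (hA : MeasurableSet A) : π.real A - ρ.real A ≤ tvDist π ρ := by
  refine le_ciSup (f := fun A : {A : Set (Vec d) // MeasurableSet A} =>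
    π.real A - ρ.real A) ⟨1, ?_⟩ ⟨A, hA⟩
  rintro _ ⟨B, rfl⟩
  have h1 : π.real B ≤ 1 := measureReal_le_one
  have h2 : 0 ≤ ρ.real B := measureReal_nonneg
  simp only
  linarith

/-- The normalized restriction of a probability measure to a set of mass at least `β⁻¹` is a
`β`-warm start. -/
theorem isWarm_cond (π : Measure (Vec d)) [IsProbabilityMeasure π] {S : Set (Vec d)} {c : ℝ}
    (hπ : ENNReal.ofReal (Real.exp (-c)) ≤ π S) :
    IsWarm (Real.exp c) π (π[|S]) := by
  have h0 : π S ≠ 0 := fun h => by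
    rw [h] at hπ
    simp only [nonpos_iff_eq_zero, ENNReal.ofReal_eq_zero] at hπ
    exact absurd hπ (not_le.2 (Real.exp_pos _))
  refine ⟨cond_isProbabilityMeasure h0, ?_⟩
  have h1 : (π S)⁻¹ ≤ ENNReal.ofReal (Real.exp c) := by
    rw [ENNReal.inv_le_iff_inv_le, ← ENNReal.ofReal_inv_of_pos (Real.exp_pos _), ← Real.exp_neg]
    exact hπ
  refine Measure.le_iff.2 fun s hs => ?_
  rw [ProbabilityTheory.cond, Measure.smul_apply, Measure.smul_apply, smul_eq_mul, smul_eq_mul]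
  gcongr
  exact Measure.restrict_le_self

/-- A set from which MALA rarely moves, whose complement has constant mass, is a bottleneck. -/
theorem le_of_tvDist_cond_le (f : Vec d → ℝ) (hf : Measurable f) (h : ℝ)
    [IsProbabilityMeasure (target f)] {S : Set (Vec d)} (hS : MeasurableSet S)
    (hS0 : target f S ≠ 0) {p a r : ℝ} (hp : (target f).real S ≤ p) (ha0 : 0 ≤ a)
    (ha : ∀ x ∈ S, acceptRate f h x ≤ ENNReal.ofReal a) {T : ℕ}
    (hT : tvDist (target f) (law f hf h ((target f)[|S]) T) ≤ r) : 1 - p - r ≤ T * a := by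
  have : IsProbabilityMeasure ((target f)[|S]) := cond_isProbabilityMeasure hS0
  have h1 := (sub_le_tvDist (target f) (law f hf h ((target f)[|S]) T) hS.compl).trans hT
  have h2 := law_compl_le f hf h ((target f)[|S]) hS
    (by rw [cond_apply hS]; simp) ha T
  have h3 : (law f hf h ((target f)[|S]) T).real Sᶜ ≤ T * a := by
    refine ENNReal.toReal_le_of_le_ofReal (by positivity) (h2.trans_eq ?_)
    rw [ENNReal.ofReal_mul (by positivity), ENNReal.ofReal_natCast]
  rw [probReal_compl_eq_one_sub hS] at h1
  linarith

/-! ### Masses of intervals and the Gaussian coordinate -/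

theorem le_target1_Icc {φ : ℝ → ℝ} {s K : ℝ} (hφ : ∀ t ∈ Set.Icc (-s) s, φ t ≤ K) :
    ENNReal.ofReal (2 * s * Real.exp (-K)) ≤ target1 φ (Set.Icc (-s) s) := by
  rw [target1, withDensity_apply _ measurableSet_Icc]
  calc ENNReal.ofReal (2 * s * Real.exp (-K))
      = ∫⁻ _ in Set.Icc (-s) s, ENNReal.ofReal (Real.exp (-K)) := by
        rw [setLIntegral_const, Real.volume_Icc, ← ENNReal.ofReal_mul (Real.exp_pos _).le]
        ring_nf
    _ ≤ _ := setLIntegral_mono' measurableSet_Icc fun t ht =>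
        ENNReal.ofReal_le_ofReal (Real.exp_le_exp.2 (neg_le_neg (hφ t ht)))

theorem target1_Icc_le {φ : ℝ → ℝ} {s K : ℝ} (hφ : ∀ t ∈ Set.Icc (-s) s, K ≤ φ t) :
    target1 φ (Set.Icc (-s) s) ≤ ENNReal.ofReal (2 * s * Real.exp (-K)) := by
  rw [target1, withDensity_apply _ measurableSet_Icc]
  calc _ ≤ ∫⁻ _ in Set.Icc (-s) s, ENNReal.ofReal (Real.exp (-K)) :=
        setLIntegral_mono' measurableSet_Icc fun t ht =>
          ENNReal.ofReal_le_ofReal (Real.exp_le_exp.2 (neg_le_neg (hφ t ht)))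
    _ = ENNReal.ofReal (2 * s * Real.exp (-K)) := by
        rw [setLIntegral_const, Real.volume_Icc, ← ENNReal.ofReal_mul (Real.exp_pos _).le]
        ring_nf

/-- The potential of the standard Gaussian on `ℝ`. -/
def gaussPot (t : ℝ) : ℝ := t ^ 2 / 2 + Real.log (Real.sqrt (2 * Real.pi))

theorem sqrt_two_pi_pos : 0 < Real.sqrt (2 * Real.pi) := by positivity

theorem exp_neg_gaussPot (t : ℝ) :
    Real.exp (-gaussPot t) = (Real.sqrt (2 * Real.pi))⁻¹ * Real.exp (-t ^ 2 / 2) := by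
  rw [gaussPot, neg_add, Real.exp_add, Real.exp_neg (Real.log _), Real.exp_log sqrt_two_pi_pos,
    mul_comm, neg_div]

theorem target1_gaussPot : target1 gaussPot = gaussianReal 0 1 := by
  rw [gaussianReal_of_var_ne_zero _ one_ne_zero, target1]
  congr 1
  funext t
  rw [gaussianPDF, exp_neg_gaussPot, gaussianPDFReal]
  simp

instance : IsProbabilityMeasure (target1 gaussPot) := by
  rw [target1_gaussPot]; infer_instance

theorem contDiff_gaussPot : ContDiff ℝ 2 gaussPot := by unfold gaussPot; fun_prop

theorem deriv_gaussPot : deriv gaussPot = id := by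
  funext t
  have : HasDerivAt gaussPot (2 * t / 2) t := by
    unfold gaussPot
    simpa using ((hasDerivAt_pow 2 t).div_const 2).add_const (Real.log (Real.sqrt (2 * Real.pi)))
  rw [this.deriv]; simp

theorem deriv_deriv_gaussPot (t : ℝ) : deriv (deriv gaussPot) t = 1 := by
  rw [deriv_gaussPot]; simp

/-- The trapezoidal rule is exact for a quadratic potential, so only the difference of squared
gradients survives. -/
theorem logRatio_gaussPot {h : ℝ} (hh : 0 < h) (a b : ℝ) :
    logRatio gaussPot h a b = h / 4 * (a ^ 2 - b ^ 2) := by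
  simp only [logRatio, deriv_gaussPot, gaussPot, id]
  field_simp
  ring

theorem sqrt_two_pi_ge : 5 / 2 ≤ Real.sqrt (2 * Real.pi) :=
  Real.le_sqrt_of_sq_le (by nlinarith [Real.pi_gt_d2])

theorem sqrt_two_pi_le : Real.sqrt (2 * Real.pi) ≤ 251 / 100 :=
  Real.sqrt_le_iff.2 ⟨by norm_num, by nlinarith [Real.pi_lt_d2]⟩

theorem gaussPot_Icc_le {s : ℝ} (hs : 0 ≤ s) :
    target1 gaussPot (Set.Icc (-s) s) ≤ ENNReal.ofReal (4 / 5 * s) := by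
  refine (target1_Icc_le (K := Real.log (Real.sqrt (2 * Real.pi))) fun t _ => ?_).trans
    (ENNReal.ofReal_le_ofReal ?_)
  · unfold gaussPot; nlinarith [sq_nonneg t]
  · rw [Real.exp_neg, Real.exp_log sqrt_two_pi_pos]
    have : (Real.sqrt (2 * Real.pi))⁻¹ ≤ (5 / 2)⁻¹ := inv_anti₀ (by norm_num) sqrt_two_pi_ge
    nlinarith

theorem le_gaussPot_Icc {s : ℝ} (hs : 0 ≤ s) :
    ENNReal.ofReal (200 / 251 * s * Real.exp (-s ^ 2 / 2)) ≤
      target1 gaussPot (Set.Icc (-s) s) := by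
  refine (ENNReal.ofReal_le_ofReal ?_).trans
    (le_target1_Icc (K := gaussPot s) fun t ht => ?_)
  · rw [exp_neg_gaussPot]
    have : (251 / 100)⁻¹ ≤ (Real.sqrt (2 * Real.pi))⁻¹ := inv_anti₀ sqrt_two_pi_pos sqrt_two_pi_le
    have h2 : 0 ≤ s * Real.exp (-s ^ 2 / 2) := by positivity
    nlinarith
  · unfold gaussPot
    have : t ^ 2 ≤ s ^ 2 := sq_le_sq' ht.1 ht.2
    linarith

/-- The integral is Gaussian and equals `(1 + h²)^(-1/2) * exp (a² h² / (2 (1 + h²)))`. With `a² ≤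
1/2` and `h² / (1 + h²) ≤ log (1 + h²)`, the second factor gives back at most half of the exponent
of the first. -/
theorem gaussPot_factor_le {h a : ℝ} (hh : 0 < h) (ha : a ^ 2 ≤ 1 / 2) :
    ∫⁻ g, ENNReal.ofReal (Real.exp (logRatio gaussPot h a
      (a - h * deriv gaussPot a + Real.sqrt (2 * h) * g))) ∂(gaussianReal 0 1) ≤
      ENNReal.ofReal (Real.exp (-(Real.log (1 + h ^ 2) / 4))) := by
  have hB : 0 < (1 + h ^ 2) / 2 := by positivity
  have hs : Real.sqrt (2 * h) ^ 2 = 2 * h := Real.sq_sqrt (by positivity)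
  set s := Real.sqrt (2 * h)
  -- The shift that completes the square in `g`.
  set c := h * (1 - h) * a * s / (2 * (1 + h ^ 2)) with hc
  have hm : Measurable fun g => ENNReal.ofReal (Real.exp (logRatio gaussPot h a
      (a - h * deriv gaussPot a + s * g))) := by
    simp_rw [logRatio_gaussPot hh]; fun_prop
  have key : ∀ g : ℝ, gaussianPDFReal 0 1 g * Real.exp (logRatio gaussPot h a
      (a - h * deriv gaussPot a + s * g)) =
      (Real.sqrt (2 * Real.pi))⁻¹ * Real.exp (a ^ 2 * h ^ 2 / (2 * (1 + h ^ 2))) *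
        Real.exp (-((1 + h ^ 2) / 2) * (g + c) ^ 2) := by
    intro g
    rw [gaussianPDFReal, logRatio_gaussPot hh, deriv_gaussPot]
    simp only [NNReal.coe_one, mul_one, sub_zero, id]
    rw [mul_assoc, mul_assoc, ← Real.exp_add, ← Real.exp_add]
    congr 2
    have e1 : (g + c) ^ 2 = g ^ 2 + h * (1 - h) * a * s * g / (1 + h ^ 2) +
        h ^ 2 * (1 - h) ^ 2 * a ^ 2 * (2 * h) / (4 * (1 + h ^ 2) ^ 2) := by
      rw [← hs, hc]; field_simp; ring
    have e2 : (a - h * a + s * g) ^ 2 = (1 - h) ^ 2 * a ^ 2 + 2 * (1 - h) * a * s * g +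
        2 * h * g ^ 2 := by rw [← hs]; ring
    rw [e1, e2]
    field_simp
    ring
  have hint : Integrable fun g : ℝ => Real.exp (-((1 + h ^ 2) / 2) * (g + c) ^ 2) :=
    (integrable_exp_neg_mul_sq hB).comp_add_right c
  rw [gaussianReal_of_var_ne_zero _ one_ne_zero,
    lintegral_withDensity_eq_lintegral_mul _ (measurable_gaussianPDF _ _) hm]
  simp only [Pi.mul_apply, gaussianPDF]
  simp_rw [← ENNReal.ofReal_mul (gaussianPDFReal_nonneg _ _ _), key]
  rw [← ofReal_integral_eq_lintegral_ofReal (hint.const_mul _)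
    (Filter.Eventually.of_forall fun g => by positivity), integral_const_mul,
    integral_add_right_eq_self (fun g : ℝ => Real.exp (-((1 + h ^ 2) / 2) * g ^ 2)),
    integral_gaussian]
  refine ENNReal.ofReal_le_ofReal ?_
  have e3 : Real.sqrt (Real.pi / ((1 + h ^ 2) / 2)) =
      Real.sqrt (2 * Real.pi) * Real.exp (-(Real.log (1 + h ^ 2) / 2)) := by
    rw [show Real.pi / ((1 + h ^ 2) / 2) = 2 * Real.pi / (1 + h ^ 2) by field_simp,
      Real.sqrt_div (by positivity), div_eq_mul_inv, Real.exp_neg, ← Real.log_sqrt (by positivity),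
      Real.exp_log (by positivity)]
  rw [e3]
  have e4 : (Real.sqrt (2 * Real.pi))⁻¹ * Real.exp (a ^ 2 * h ^ 2 / (2 * (1 + h ^ 2))) *
      (Real.sqrt (2 * Real.pi) * Real.exp (-(Real.log (1 + h ^ 2) / 2))) =
      Real.exp (a ^ 2 * h ^ 2 / (2 * (1 + h ^ 2)) + -(Real.log (1 + h ^ 2) / 2)) := by
    rw [Real.exp_add]
    have := sqrt_two_pi_pos.ne'
    field_simp
  rw [e4, Real.exp_le_exp]
  have h1 : h ^ 2 / (1 + h ^ 2) ≤ Real.log (1 + h ^ 2) := by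
    have := Real.one_sub_inv_le_log_of_pos (show 0 < 1 + h ^ 2 by positivity)
    refine le_trans (le_of_eq ?_) this
    field_simp; ring
  have h2 : a ^ 2 * h ^ 2 / (2 * (1 + h ^ 2)) = a ^ 2 / 2 * (h ^ 2 / (1 + h ^ 2)) := by
    field_simp
  have h3 : a ^ 2 / 2 * (h ^ 2 / (1 + h ^ 2)) ≤ 1 / 4 * (h ^ 2 / (1 + h ^ 2)) := by
    exact mul_le_mul_of_nonneg_right (by linarith) (by positivity)
  linarith

/-! ### The bump profile and its rejection factor -/

/-- A convex function with second derivative in `[1/10, 1]`, close to quadratic near `0` and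
flatter away from it. -/
def profile (u : ℝ) : ℝ := u ^ 2 / 20 + 9 / 10 * (Real.sqrt (1 + u ^ 2) - 1)

/-- The derivative of `profile`. -/
def profile' (u : ℝ) : ℝ := u / 10 + 9 / 10 * (u / Real.sqrt (1 + u ^ 2))

theorem sqrt_one_add_sq_pos (u : ℝ) : 0 < Real.sqrt (1 + u ^ 2) := by positivity

theorem sq_sqrt_one_add_sq (u : ℝ) : Real.sqrt (1 + u ^ 2) ^ 2 = 1 + u ^ 2 :=
  Real.sq_sqrt (by positivity)

theorem one_le_sqrt_one_add_sq (u : ℝ) : 1 ≤ Real.sqrt (1 + u ^ 2) :=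
  Real.one_le_sqrt.2 (by nlinarith [sq_nonneg u])

theorem hasDerivAt_sqrt_one_add_sq (u : ℝ) :
    HasDerivAt (fun u => Real.sqrt (1 + u ^ 2)) (u / Real.sqrt (1 + u ^ 2)) u := by
  have h := ((hasDerivAt_pow 2 u).const_add 1).sqrt (by positivity)
  convert h using 1
  have := (sqrt_one_add_sq_pos u).ne'
  field_simp
  norm_num
  ring

theorem hasDerivAt_profile (u : ℝ) : HasDerivAt profile (profile' u) u := by
  have h := ((hasDerivAt_pow 2 u).div_const 20).add
    (((hasDerivAt_sqrt_one_add_sq u).sub_const 1).const_mul (9 / 10))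
  refine (show HasDerivAt profile _ u from h).congr_deriv ?_
  simp only [profile']
  norm_num
  ring

theorem hasDerivAt_profile' (u : ℝ) :
    HasDerivAt profile' (1 / 10 + 9 / 10 * (1 / Real.sqrt (1 + u ^ 2) ^ 3)) u := by
  have h := ((hasDerivAt_id u).div_const 10).add
    (((hasDerivAt_id u).div (hasDerivAt_sqrt_one_add_sq u)
      (sqrt_one_add_sq_pos u).ne').const_mul (9 / 10))
  refine (show HasDerivAt profile' _ u from h).congr_deriv ?_
  have h1 := (sqrt_one_add_sq_pos u).ne'
  have h2 := sq_sqrt_one_add_sq u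
  simp only [id]
  field_simp
  rw [h2]
  ring

theorem contDiff_profile : ContDiff ℝ 2 profile := by
  unfold profile
  have : ContDiff ℝ 2 fun u : ℝ => Real.sqrt (1 + u ^ 2) :=
    ContDiff.sqrt (by fun_prop) fun u => by positivity
  fun_prop

theorem profile_ge (u : ℝ) : u ^ 2 / 20 ≤ profile u := by
  have := one_le_sqrt_one_add_sq u
  unfold profile; linarith

theorem profile_le (u : ℝ) : profile u ≤ u ^ 2 / 2 := by
  have h1 := one_le_sqrt_one_add_sq u
  have h2 := sq_sqrt_one_add_sq u
  unfold profile; nlinarith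

theorem abs_profile'_le (u : ℝ) : |profile' u| ≤ |u| := by
  have h1 := one_le_sqrt_one_add_sq u
  have : profile' u = u * (1 / 10 + 9 / 10 * (1 / Real.sqrt (1 + u ^ 2))) := by
    unfold profile'; ring
  have h3 : 1 / Real.sqrt (1 + u ^ 2) ≤ 1 := (div_le_one (by linarith)).2 h1
  have h4 : 0 ≤ 1 / Real.sqrt (1 + u ^ 2) := by positivity
  rw [this, abs_mul, abs_of_nonneg (a := 1 / 10 + _) (by linarith)]
  exact mul_le_of_le_one_right (abs_nonneg _) (by linarith)

theorem mul_profile'_nonneg (u : ℝ) : 0 ≤ u * profile' u := by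
  have : u * profile' u = u ^ 2 * (1 / 10 + 9 / 10 * (1 / Real.sqrt (1 + u ^ 2))) := by
    unfold profile'; ring
  rw [this]; positivity

/-- The error of the trapezoidal rule for `profile` on `[0, v]`, up to a factor. -/
def trapErr (v : ℝ) : ℝ := (Real.sqrt (1 + v ^ 2) - 1) ^ 2 / (2 * Real.sqrt (1 + v ^ 2))

theorem trapErr_nonneg (v : ℝ) : 0 ≤ trapErr v := by unfold trapErr; positivity

/-- The quadratic part of `profile` has no trapezoidal error. The derivative of the other part is
concave on the positive axis, so the rule underestimates; the error becomes a perfect square in `√(1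
+ v²) - 1`. -/
theorem trapErr_eq (v : ℝ) : v * profile' v / 2 - profile v = -(9 / 10 * trapErr v) := by
  have h1 := (sqrt_one_add_sq_pos v).ne'
  have h2 : v ^ 2 = Real.sqrt (1 + v ^ 2) ^ 2 - 1 := by rw [sq_sqrt_one_add_sq]; ring
  have h3 : v * profile' v / 2 - profile v =
    9 / 10 * (v ^ 2 / (2 * Real.sqrt (1 + v ^ 2)) - (Real.sqrt (1 + v ^ 2) - 1)) := by
    unfold profile' profile; field_simp; ring
  rw [h3, trapErr]
  generalize Real.sqrt (1 + v ^ 2) = r at *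
  rw [h2]
  field_simp
  ring

/-- Used in two ways: it absorbs the terms linear in `|v|` caused by starting slightly off `0`, and
it bounds `trapErr` from below when `v` is large. -/
theorem abs_le_trapErr (v : ℝ) : |v| ≤ 2 * trapErr v + 2 := by
  have h1 : |v| ≤ Real.sqrt (1 + v ^ 2) := Real.abs_le_sqrt (by linarith)
  have h2 : trapErr v = Real.sqrt (1 + v ^ 2) / 2 - 1 + 1 / (2 * Real.sqrt (1 + v ^ 2)) := by
    have := (sqrt_one_add_sq_pos v).ne'
    unfold trapErr; field_simp; ring
  have h3 : 0 < 1 / (2 * Real.sqrt (1 + v ^ 2)) := by positivity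
  linarith

/-- The logarithm of the acceptance ratio for `profile` at scale `τ`. -/
def profileRatio (τ u v : ℝ) : ℝ :=
  τ * (profile u - profile v + (v - u) * (profile' u + profile' v) / 2) +
    τ ^ 2 / 4 * (profile' u ^ 2 - profile' v ^ 2)

/-- At `u = 0` the trapezoidal term is `-(9/10) τ trapErr v` and the gradient term is nonpositive.
Moving `u` by at most `θ` adds an error of order `τ θ (1 + |v|)`, whose part growing with `v` is
absorbed by lowering `9/10` to `4/5`. -/
theorem profileRatio_le {τ θ u v : ℝ} (hτ : 0 < τ) (hτ1 : τ ≤ 1) (hθ : θ ≤ 1 / 20)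
    (hu : |u| ≤ θ) : profileRatio τ u v ≤ τ * (4 * θ - 4 / 5 * trapErr v) := by
  have hθ0 : 0 ≤ θ := (abs_nonneg u).trans hu
  have h1 := trapErr_eq v
  have h2 := abs_le_trapErr v
  have h3 := profile_le u
  have h4 := mul_profile'_nonneg u
  have h5 : v * profile' u ≤ |v| * θ := by
    calc v * profile' u ≤ |v| * |profile' u| := by rw [← abs_mul]; exact le_abs_self _
      _ ≤ |v| * θ := by gcongr; exact (abs_profile'_le u).trans hu
  have h6 : -(u * profile' v) ≤ |v| * θ := by
    calc -(u * profile' v) ≤ |u| * |profile' v| := by rw [← abs_mul]; exact neg_le_abs _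
      _ ≤ θ * |v| := mul_le_mul hu (abs_profile'_le v) (abs_nonneg _) hθ0
      _ = _ := mul_comm _ _
  have h7 : u ^ 2 ≤ θ ^ 2 := sq_le_sq' (by linarith [neg_abs_le u]) (by linarith [le_abs_self u])
  have h8 : profile' u ^ 2 ≤ θ ^ 2 := by
    have := abs_le.1 ((abs_profile'_le u).trans hu)
    exact sq_le_sq' this.1 this.2
  have h9 : τ ^ 2 / 4 * (profile' u ^ 2 - profile' v ^ 2) ≤ τ * (θ ^ 2 / 4) := by
    calc τ ^ 2 / 4 * (profile' u ^ 2 - profile' v ^ 2) ≤ τ ^ 2 / 4 * θ ^ 2 := by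
          gcongr; linarith [sq_nonneg (profile' v)]
      _ = τ * (τ * (θ ^ 2 / 4)) := by ring
      _ ≤ τ * (1 * (θ ^ 2 / 4)) := by gcongr
      _ = _ := by ring
  have h10 := trapErr_nonneg v
  have h11 : profile u - profile v + (v - u) * (profile' u + profile' v) / 2 ≤
      θ ^ 2 / 2 + |v| * θ - 9 / 10 * trapErr v := by linarith
  have h12 : |v| * θ ≤ (2 * trapErr v + 2) * θ := by gcongr
  have h13 : θ * trapErr v ≤ 1 / 20 * trapErr v := by gcongr
  have h14 : θ ^ 2 ≤ 1 / 20 * θ := by rw [sq]; gcongr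
  unfold profileRatio
  calc _ ≤ τ * (θ ^ 2 / 2 + |v| * θ - 9 / 10 * trapErr v) + τ * (θ ^ 2 / 4) := by gcongr
    _ = τ * (θ ^ 2 / 2 + |v| * θ - 9 / 10 * trapErr v + θ ^ 2 / 4) := by ring
    _ ≤ _ := by
      refine mul_le_mul_of_nonneg_left ?_ hτ.le
      linarith

/-- The probability that a standard Gaussian is at least `3`. -/
def tailProb : ℝ := (gaussianReal 0 1).real (Set.Ici 3)

theorem tailProb_pos : 0 < tailProb := by
  refine ENNReal.toReal_pos (fun h => ?_) (measure_ne_top _ _)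
  have h2 := gaussianReal_absolutelyContinuous' 0 (one_ne_zero (α := NNReal)) h
  simp at h2

theorem tailProb_le_one : tailProb ≤ 1 := measureReal_le_one

/-- The half-width, in units of the step scale, of the bottleneck of a bump coordinate. -/
def bumpWidth : ℝ := tailProb / 160

theorem bumpWidth_pos : 0 < bumpWidth := div_pos tailProb_pos (by norm_num)

theorem bumpWidth_le : bumpWidth ≤ 1 / 160 :=
  div_le_div_of_nonneg_right tailProb_le_one (by norm_num)

theorem exp_le_one_add_two_mul {z : ℝ} (h0 : 0 ≤ z) (h1 : z ≤ 1) : Real.exp z ≤ 1 + 2 * z := by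
  have := Real.abs_exp_sub_one_sub_id_le (x := z) (by rwa [abs_of_nonneg h0])
  have := (abs_le.1 this).2
  nlinarith

theorem exp_neg_le_one_sub_half {z : ℝ} (h0 : 0 ≤ z) (h1 : z ≤ 1) :
    Real.exp (-z) ≤ 1 - z / 2 := by
  have h2 : 1 + z ≤ Real.exp z := by linarith [Real.add_one_le_exp z]
  rw [Real.exp_neg]
  calc (Real.exp z)⁻¹ ≤ (1 + z)⁻¹ := inv_anti₀ (by linarith) h2
    _ ≤ 1 - z / 2 := by
      rw [inv_le_iff_one_le_mul₀ (by linarith)]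
      nlinarith

/-- With probability `tailProb` the noise carries the proposal to `v ≥ 3`, where the integrand is at
most `1 - τ/10`; elsewhere it exceeds `1` by at most `8 * bumpWidth * τ = tailProb / 20 * τ`. The
width `tailProb / 160` makes this excess exactly half of the gain `tailProb / 10 * τ`. -/
theorem profileRatio_factor_le {τ u : ℝ} (hτ : 0 < τ) (hτ1 : τ ≤ 1) (hu : |u| ≤ bumpWidth) :
    ∫⁻ g, ENNReal.ofReal (Real.exp (profileRatio τ u (u - τ * profile' u + Real.sqrt 2 * g)))
      ∂(gaussianReal 0 1) ≤ ENNReal.ofReal (Real.exp (-(tailProb / 20 * τ))) := by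
  have hw := bumpWidth_le
  have hw0 := bumpWidth_pos
  have hpt : ∀ g, Real.exp (profileRatio τ u (u - τ * profile' u + Real.sqrt 2 * g)) ≤
      1 + 8 * bumpWidth * τ - (Set.Ici 3).indicator (fun _ => τ / 10) g := by
    intro g
    have hb := profileRatio_le (v := u - τ * profile' u + Real.sqrt 2 * g) hτ hτ1
      (by linarith) hu
    have hq := trapErr_nonneg (u - τ * profile' u + Real.sqrt 2 * g)
    by_cases hg : g ∈ Set.Ici (3 : ℝ)
    · rw [Set.indicator_of_mem hg]
      have h1 : |τ * profile' u| ≤ 1 / 160 := by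
        rw [abs_mul, abs_of_pos hτ]
        calc τ * |profile' u| ≤ 1 * |u| := mul_le_mul hτ1 (abs_profile'_le u) (abs_nonneg _) one_pos.le
          _ ≤ 1 / 160 := by linarith
      have h2 : (7 / 5 : ℝ) ≤ Real.sqrt 2 := Real.le_sqrt_of_sq_le (by norm_num)
      have h3 : 7 / 5 * 3 ≤ Real.sqrt 2 * g := by
        have : (3 : ℝ) ≤ g := hg
        gcongr
      have h4 : 3 ≤ u - τ * profile' u + Real.sqrt 2 * g := by
        linarith [(abs_le.1 h1).2, (abs_le.1 hu).1]
      have h5 := (le_abs_self _).trans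
        (abs_le_trapErr (u - τ * profile' u + Real.sqrt 2 * g))
      have h6 : Real.exp (profileRatio τ u (u - τ * profile' u + Real.sqrt 2 * g)) ≤
          Real.exp (-(τ / 5)) := by
        refine Real.exp_le_exp.2 (hb.trans ?_)
        nlinarith
      have h7 := exp_neg_le_one_sub_half (z := τ / 5) (by positivity) (by linarith)
      have h8 : 0 < 8 * bumpWidth * τ := by positivity
      linarith
    · rw [Set.indicator_of_notMem hg]
      have h6 : Real.exp (profileRatio τ u (u - τ * profile' u + Real.sqrt 2 * g)) ≤
          Real.exp (4 * bumpWidth * τ) := by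
        refine Real.exp_le_exp.2 (hb.trans ?_)
        nlinarith
      have h7 := exp_le_one_add_two_mul (z := 4 * bumpWidth * τ) (by positivity) (by nlinarith)
      linarith
  have hi : Integrable (fun g : ℝ => (Set.Ici (3 : ℝ)).indicator (fun _ => τ / 10) g)
      (gaussianReal 0 1) := (integrable_const _).indicator measurableSet_Ici
  calc _ ≤ ∫⁻ g, ENNReal.ofReal (1 + 8 * bumpWidth * τ -
        (Set.Ici (3 : ℝ)).indicator (fun _ => τ / 10) g) ∂(gaussianReal 0 1) :=
        lintegral_mono fun g => ENNReal.ofReal_le_ofReal (hpt g)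
    _ = ENNReal.ofReal (∫ g, (1 + 8 * bumpWidth * τ -
        (Set.Ici (3 : ℝ)).indicator (fun _ => τ / 10) g) ∂(gaussianReal 0 1)) :=
        (ofReal_integral_eq_lintegral_ofReal ((integrable_const _).sub hi)
          (Filter.Eventually.of_forall fun g => (Real.exp_pos _).le.trans (hpt g))).symm
    _ ≤ _ := by
        refine ENNReal.ofReal_le_ofReal ?_
        rw [integral_sub (integrable_const _) hi, integral_indicator_const _ measurableSet_Ici,
          integral_const, probReal_univ, one_smul, smul_eq_mul]
        have := Real.add_one_le_exp (-(tailProb / 20 * τ))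
        change 1 + 8 * bumpWidth * τ - tailProb * (τ / 10) ≤ _
        unfold bumpWidth
        linarith

/-! ### The bump potential at scale `s` -/

/-- `profile` at spatial scale `s` and curvature `κ`. -/
def scaledProfile (κ s t : ℝ) : ℝ := κ * s ^ 2 * profile (t / s)

/-- The normalizing constant of `scaledProfile`. -/
def bumpZ (κ s : ℝ) : ℝ := ∫ t, Real.exp (-scaledProfile κ s t)

/-- The normalized potential `scaledProfile`. -/
def bumpPot (κ s t : ℝ) : ℝ := scaledProfile κ s t + Real.log (bumpZ κ s)

theorem contDiff_scaledProfile (κ s : ℝ) : ContDiff ℝ 2 (scaledProfile κ s) := by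
  unfold scaledProfile
  exact contDiff_const.mul (contDiff_profile.comp (contDiff_id.div_const s))

theorem contDiff_bumpPot (κ s : ℝ) : ContDiff ℝ 2 (bumpPot κ s) :=
  (contDiff_scaledProfile κ s).add contDiff_const

theorem deriv_bumpPot {κ s : ℝ} (hs : 0 < s) :
    deriv (bumpPot κ s) = fun t => κ * s * profile' (t / s) := by
  funext t
  have h := (((hasDerivAt_profile (t / s)).comp t ((hasDerivAt_id t).div_const s)).const_mul
    (κ * s ^ 2)).add_const (Real.log (bumpZ κ s))
  have h2 : HasDerivAt (bumpPot κ s) (κ * s ^ 2 * (profile' (t / s) * (1 / s))) t := h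
  rw [h2.deriv]
  field_simp

theorem deriv_deriv_bumpPot {κ s : ℝ} (hs : 0 < s) (t : ℝ) :
    deriv (deriv (bumpPot κ s)) t =
      κ * (1 / 10 + 9 / 10 * (1 / Real.sqrt (1 + (t / s) ^ 2) ^ 3)) := by
  rw [deriv_bumpPot hs]
  have h := ((hasDerivAt_profile' (t / s)).comp t ((hasDerivAt_id t).div_const s)).const_mul
    (κ * s)
  have h2 : HasDerivAt (fun t => κ * s * profile' (t / s)) (κ * s *
    ((1 / 10 + 9 / 10 * (1 / Real.sqrt (1 + (t / s) ^ 2) ^ 3)) * (1 / s))) t := h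
  rw [h2.deriv]
  field_simp

theorem one_le_deriv_deriv_bumpPot {κ s : ℝ} (hκ : 10 ≤ κ) (hs : 0 < s) (t : ℝ) :
    1 ≤ deriv (deriv (bumpPot κ s)) t := by
  rw [deriv_deriv_bumpPot hs]
  have : 0 < 1 / Real.sqrt (1 + (t / s) ^ 2) ^ 3 := by positivity
  nlinarith

theorem deriv_deriv_bumpPot_le {κ s : ℝ} (hκ : 0 ≤ κ) (hs : 0 < s) (t : ℝ) :
    deriv (deriv (bumpPot κ s)) t ≤ κ := by
  rw [deriv_deriv_bumpPot hs]
  have : 1 / Real.sqrt (1 + (t / s) ^ 2) ^ 3 ≤ 1 :=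
    (div_le_one (by positivity)).2 (one_le_pow₀ (one_le_sqrt_one_add_sq _))
  exact mul_le_of_le_one_right hκ (by linarith)

theorem scaledProfile_ge {κ s : ℝ} (hκ : 0 ≤ κ) (hs : 0 < s) (t : ℝ) :
    κ / 20 * t ^ 2 ≤ scaledProfile κ s t := by
  unfold scaledProfile
  calc κ / 20 * t ^ 2 = κ * s ^ 2 * ((t / s) ^ 2 / 20) := by field_simp
    _ ≤ _ := by gcongr; exact profile_ge _

theorem integrable_exp_neg_scaledProfile {κ s : ℝ} (hκ : 0 < κ) (hs : 0 < s) :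
    Integrable fun t => Real.exp (-scaledProfile κ s t) := by
  refine (integrable_exp_neg_mul_sq (b := κ / 20) (by positivity)).mono' ?_ ?_
  · have := (contDiff_scaledProfile κ s).continuous
    exact (by fun_prop : Continuous fun t => Real.exp (-scaledProfile κ s t)).aestronglyMeasurable
  · refine Filter.Eventually.of_forall fun t => ?_
    rw [Real.norm_of_nonneg (Real.exp_pos _).le, Real.exp_le_exp]
    linarith [scaledProfile_ge hκ.le hs t]

theorem bumpZ_pos {κ s : ℝ} (hκ : 0 < κ) (hs : 0 < s) : 0 < bumpZ κ s :=
  integral_exp_pos (integrable_exp_neg_scaledProfile hκ hs)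

theorem bumpZ_le {κ s : ℝ} (hκ : 0 < κ) (hs : 0 < s) : bumpZ κ s ≤ 8 / Real.sqrt κ := by
  calc bumpZ κ s ≤ ∫ t, Real.exp (-(κ / 20) * t ^ 2) := by
        refine integral_mono (integrable_exp_neg_scaledProfile hκ hs)
          (integrable_exp_neg_mul_sq (by positivity)) fun t => ?_
        rw [Real.exp_le_exp]
        linarith [scaledProfile_ge hκ.le hs t]
    _ = Real.sqrt (20 * Real.pi) / Real.sqrt κ := by
        rw [integral_gaussian, ← Real.sqrt_div (by positivity)]
        congr 1; field_simp
    _ ≤ 8 / Real.sqrt κ := by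
        gcongr
        exact Real.sqrt_le_iff.2 ⟨by norm_num, by nlinarith [Real.pi_lt_d2]⟩

theorem exp_neg_bumpPot {κ s : ℝ} (hκ : 0 < κ) (hs : 0 < s) (t : ℝ) :
    Real.exp (-bumpPot κ s t) = Real.exp (-scaledProfile κ s t) * (bumpZ κ s)⁻¹ := by
  rw [bumpPot, neg_add, Real.exp_add, Real.exp_neg (Real.log _), Real.exp_log (bumpZ_pos hκ hs)]

theorem isProbabilityMeasure_bumpPot {κ s : ℝ} (hκ : 0 < κ) (hs : 0 < s) :
    IsProbabilityMeasure (target1 (bumpPot κ s)) := by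
  constructor
  rw [target1, withDensity_apply _ MeasurableSet.univ, Measure.restrict_univ]
  simp_rw [exp_neg_bumpPot hκ hs]
  rw [← ofReal_integral_eq_lintegral_ofReal
    ((integrable_exp_neg_scaledProfile hκ hs).mul_const _)
    (Filter.Eventually.of_forall fun t =>
      mul_nonneg (Real.exp_pos _).le (inv_nonneg.2 (bumpZ_pos hκ hs).le)),
    integral_mul_const]
  change ENNReal.ofReal (bumpZ κ s * (bumpZ κ s)⁻¹) = 1
  rw [mul_inv_cancel₀ (bumpZ_pos hκ hs).ne', ENNReal.ofReal_one]

/-- Since `κ s² ≤ 1`, the potential is nearly constant on the interval, and the normalizing constant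
is of order at most `1 / √κ`; the mass is therefore at least of order `s √κ`. -/
theorem le_bumpPot_Icc {κ s : ℝ} (hκ : 0 < κ) (hs : 0 < s) (hτ : κ * s ^ 2 ≤ 1) :
    ENNReal.ofReal (bumpWidth / 8 * Real.sqrt (κ * s ^ 2)) ≤
      target1 (bumpPot κ s) (Set.Icc (-(bumpWidth * s)) (bumpWidth * s)) := by
  have hw := bumpWidth_le
  have hw0 := bumpWidth_pos
  refine (ENNReal.ofReal_le_ofReal ?_).trans
    (le_target1_Icc (K := 1 / 2 + Real.log (bumpZ κ s)) fun t ht => ?_)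
  · rw [neg_add, Real.exp_add, Real.exp_neg (Real.log _), Real.exp_log (bumpZ_pos hκ hs),
      Real.sqrt_mul hκ.le, Real.sqrt_sq hs.le]
    have h1 : 1 / 2 ≤ Real.exp (-(1 / 2)) := by
      have := Real.add_one_le_exp (-(1 / 2) : ℝ); linarith
    have h2 : Real.sqrt κ / 8 ≤ (bumpZ κ s)⁻¹ := by
      rw [show Real.sqrt κ / 8 = (8 / Real.sqrt κ)⁻¹ by rw [inv_div]]
      exact inv_anti₀ (bumpZ_pos hκ hs) (bumpZ_le hκ hs)
    calc bumpWidth / 8 * (Real.sqrt κ * s) =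
        2 * (bumpWidth * s) * (1 / 2 * (Real.sqrt κ / 8)) := by ring
      _ ≤ _ := by gcongr
  · unfold bumpPot scaledProfile
    have h1 : |t / s| ≤ 1 := by
      rw [abs_div, abs_of_pos hs, div_le_one hs]
      have : |t| ≤ bumpWidth * s := abs_le.2 ht
      nlinarith
    have h2 : (t / s) ^ 2 ≤ 1 := (sq_le_one_iff_abs_le_one _).2 h1
    have h3 := profile_le (t / s)
    have h4 : κ * s ^ 2 * profile (t / s) ≤ κ * s ^ 2 * (1 / 2) := by gcongr; linarith
    linarith

/-- Choosing the spatial scale `s = √h` removes the step size: only the dimensionless product `κ s²`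
remains. -/
theorem logRatio_bumpPot {κ s : ℝ} (hs : 0 < s) (u v : ℝ) :
    logRatio (bumpPot κ s) (s ^ 2) (s * u) (s * v) = profileRatio (κ * s ^ 2) u v := by
  simp only [logRatio, deriv_bumpPot hs, bumpPot, scaledProfile, profileRatio]
  rw [mul_div_cancel_left₀ _ hs.ne', mul_div_cancel_left₀ _ hs.ne']
  field_simp
  ring

theorem bumpPot_factor_le {κ s a : ℝ} (hκ : 0 < κ) (hs : 0 < s) (hτ : κ * s ^ 2 ≤ 1)
    (ha : a ∈ Set.Icc (-(bumpWidth * s)) (bumpWidth * s)) :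
    ∫⁻ g, ENNReal.ofReal (Real.exp (logRatio (bumpPot κ s) (s ^ 2) a
      (a - s ^ 2 * deriv (bumpPot κ s) a + Real.sqrt (2 * s ^ 2) * g))) ∂(gaussianReal 0 1) ≤
      ENNReal.ofReal (Real.exp (-(tailProb / 20 * (κ * s ^ 2)))) := by
  obtain ⟨u, rfl⟩ : ∃ u, a = s * u := ⟨a / s, by field_simp⟩
  have hu : |u| ≤ bumpWidth := by
    have : |s * u| ≤ bumpWidth * s := abs_le.2 ha
    rw [abs_mul, abs_of_pos hs, mul_comm] at this
    exact le_of_mul_le_mul_right this hs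
  refine (le_of_eq ?_).trans (profileRatio_factor_le (by positivity) hτ hu)
  refine lintegral_congr fun g => ?_
  rw [← logRatio_bumpPot hs, deriv_bumpPot hs, Real.sqrt_mul (by norm_num), Real.sqrt_sq hs.le]
  simp only [mul_div_cancel_left₀ _ hs.ne']
  congr 3
  ring

/-! ### Small steps: slow spreading for the standard Gaussian -/

/-- The potential of the standard Gaussian on `ℝ^d`. -/
def stdPot (d : ℕ) : Vec d → ℝ := sep fun _ => gaussPot

theorem hessianBetween_stdPot {κ : ℝ} (hκ : 1 ≤ κ) : HessianBetween κ (stdPot d) :=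
  hessianBetween_sep (fun _ => contDiff_gaussPot) (fun _ t => (deriv_deriv_gaussPot t).ge)
    fun _ t => (deriv_deriv_gaussPot t).trans_le hκ

instance : IsProbabilityMeasure (target (stdPot d)) :=
  isProbabilityMeasure_target_sep fun _ => contDiff_gaussPot.continuous.measurable

theorem measurable_stdPot : Measurable (stdPot d) :=
  (hessianBetween_stdPot le_rfl).measurable

/-- The linear isometry that changes the sign of the `i`-th coordinate. -/
def flip (i : Fin d) : Vec d ≃ₗᵢ[ℝ] Vec d :=
  LinearIsometryEquiv.piLpCongrRight 2 fun j =>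
    if j = i then LinearIsometryEquiv.neg ℝ else LinearIsometryEquiv.refl ℝ ℝ

theorem flip_apply (i j : Fin d) (g : Vec d) : flip i g j = if j = i then -g j else g j := by
  rw [flip, LinearIsometryEquiv.piLpCongrRight_apply]
  split_ifs with h <;> simp [h]

theorem acceptProb_stdPot {h : ℝ} (hh : 0 < h) (x y : Vec d) :
    acceptProb (stdPot d) h x y = min 1 (Real.exp (h / 4 * ∑ j, (x j ^ 2 - y j ^ 2))) := by
  rw [stdPot, acceptProb_sep fun _ => contDiff_gaussPot.differentiable (by norm_num),
    Finset.mul_sum]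
  simp_rw [logRatio_gaussPot hh]

theorem acceptProb_stdPot_anti {h : ℝ} (hh : 0 < h) (x y z : Vec d) (i : Fin d)
    (hi : y i ^ 2 ≤ z i ^ 2) (hj : ∀ j, j ≠ i → y j = z j) :
    acceptProb (stdPot d) h x z ≤ acceptProb (stdPot d) h x y := by
  rw [acceptProb_stdPot hh, acceptProb_stdPot hh]
  refine min_le_min_left _ (Real.exp_le_exp.2 (mul_le_mul_of_nonneg_left ?_ (by positivity)))
  refine Finset.sum_le_sum fun j _ => ?_
  by_cases h : j = i
  · subst h; linarith
  · rw [hj j h]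

theorem drift_stdPot (h : ℝ) (x : Vec d) (i : Fin d) :
    drift (stdPot d) h x i = (1 - h) * x i := by
  rw [stdPot, drift_sep fun _ => contDiff_gaussPot.differentiable (by norm_num), deriv_gaussPot]
  simp only [id]; ring

theorem lintegral_sq_gaussianReal :
    ∫⁻ t, ENNReal.ofReal (t ^ 2) ∂(gaussianReal 0 1) = 1 := by
  have h := variance_of_integral_eq_zero (X := id) (μ := gaussianReal 0 1) aemeasurable_id
    (by simp)
  rw [variance_id_gaussianReal] at h
  have hi : Integrable (fun t : ℝ => t ^ 2) (gaussianReal 0 1) :=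
    (memLp_id_gaussianReal (μ := 0) (v := 1) 2).integrable_sq
  rw [← ofReal_integral_eq_lintegral_ofReal hi
    (Filter.Eventually.of_forall fun t => sq_nonneg t)]
  simp only [id] at h
  rw [← h]; simp

theorem lintegral_sq_stdGaussian (i : Fin d) :
    ∫⁻ g, ENNReal.ofReal ((g i) ^ 2) ∂(stdGaussian (Vec d)) = 1 := by
  rw [← map_pi_eq_stdGaussian, lintegral_map (by fun_prop) (by fun_prop),
    ← lintegral_sq_gaussianReal]
  exact (measurePreserving_eval (fun _ : Fin d => gaussianReal 0 1) i).lintegral_comp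
    (f := fun t => ENNReal.ofReal (t ^ 2)) (by fun_prop)

/-- Here `a ± b` are the two proposals of a reflected pair and `p`, `q` their acceptance
probabilities. The larger square has the smaller probability, so the cross term `2 a b (p - q)` is
nonpositive. -/
theorem sq_mul_add_sq_mul_le {a b p q : ℝ} (hp : p ≤ 1) (hq : q ≤ 1)
    (h1 : (a - b) ^ 2 ≤ (a + b) ^ 2 → p ≤ q) (h2 : (a + b) ^ 2 ≤ (a - b) ^ 2 → q ≤ p) :
    (a + b) ^ 2 * p + (a - b) ^ 2 * q ≤ a ^ 2 * (p + q) + 2 * b ^ 2 := by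
  have h3 : a * b * (p - q) ≤ 0 := by
    rcases le_total 0 (a * b) with h | h
    · exact mul_nonpos_of_nonneg_of_nonpos h (by linarith [h1 (by nlinarith)])
    · exact mul_nonpos_of_nonpos_of_nonneg h (by linarith [h2 (by nlinarith)])
  nlinarith [mul_nonneg (sq_nonneg b) (by linarith : 0 ≤ 2 - p - q)]

/-- Noise vectors are paired by flipping the sign of coordinate `i`, which preserves the Gaussian
law. Within a pair the filter favours the proposal with the smaller `i`-th coordinate, so the
correlation of acceptance with `y i ^ 2` cannot increase the second moment, and only the noise
variance `2h` is added. -/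
theorem lintegral_sq_mul_acceptProb_le {h : ℝ} (hh : 0 < h) (hh1 : h ≤ 1) (x : Vec d)
    (i : Fin d) :
    ∫⁻ y, ENNReal.ofReal (y i ^ 2) * ENNReal.ofReal (acceptProb (stdPot d) h x y)
      ∂(proposal (stdPot d) h x) ≤
      ENNReal.ofReal (x i ^ 2) * acceptRate (stdPot d) h x + ENNReal.ofReal (2 * h) := by
  set f := stdPot d
  set Y : Vec d → Vec d := fun g => drift f h x + Real.sqrt (2 * h) • g with hY
  have hYm : Measurable Y := measurable_proposalMap f h x
  have hα : Measurable fun g => ENNReal.ofReal (acceptProb f h x (Y g)) :=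
    (measurable_acceptProb_right measurable_stdPot h x).comp hYm
  have hF : Measurable fun g => ENNReal.ofReal (Y g i ^ 2) *
      ENNReal.ofReal (acceptProb f h x (Y g)) := by
    refine Measurable.mul ?_ hα
    exact (by fun_prop : Measurable fun y : Vec d => ENNReal.ofReal (y i ^ 2)).comp hYm
  have hflip : ∀ G : Vec d → ℝ≥0∞, Measurable G →
      ∫⁻ g, G (flip i g) ∂(stdGaussian (Vec d)) = ∫⁻ g, G g ∂(stdGaussian (Vec d)) := by
    intro G hG
    conv_rhs => rw [← stdGaussian_map (flip i),
      lintegral_map hG (flip i).continuous.measurable]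
  have hrate : acceptRate f h x =
      ∫⁻ g, ENNReal.ofReal (acceptProb f h x (Y g)) ∂(stdGaussian (Vec d)) := by
    rw [acceptRate, proposal, lintegral_map (measurable_acceptProb_right measurable_stdPot h x)
      hYm]
  have hint : ∫⁻ y, ENNReal.ofReal (y i ^ 2) * ENNReal.ofReal (acceptProb f h x y)
      ∂(proposal f h x) = ∫⁻ g, ENNReal.ofReal (Y g i ^ 2) *
      ENNReal.ofReal (acceptProb f h x (Y g)) ∂(stdGaussian (Vec d)) := by
    rw [proposal, lintegral_map (f := fun y => ENNReal.ofReal (y i ^ 2) *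
      ENNReal.ofReal (acceptProb f h x y)) _ hYm]
    have := measurable_acceptProb_right (f := f) measurable_stdPot h x
    fun_prop
  rw [hint, hrate]
  have hpt : ∀ g, ENNReal.ofReal (Y g i ^ 2) * ENNReal.ofReal (acceptProb f h x (Y g)) +
      ENNReal.ofReal (Y (flip i g) i ^ 2) *
        ENNReal.ofReal (acceptProb f h x (Y (flip i g))) ≤
      ENNReal.ofReal (x i ^ 2) * (ENNReal.ofReal (acceptProb f h x (Y g)) +
        ENNReal.ofReal (acceptProb f h x (Y (flip i g)))) +
        ENNReal.ofReal (4 * h) * ENNReal.ofReal (g i ^ 2) := by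
    intro g
    have hp0 := acceptProb_nonneg f h x (Y g)
    have hq0 := acceptProb_nonneg f h x (Y (flip i g))
    rw [← ENNReal.ofReal_mul (by positivity), ← ENNReal.ofReal_mul (by positivity),
      ← ENNReal.ofReal_mul (by positivity), ← ENNReal.ofReal_add hp0 hq0,
      ← ENNReal.ofReal_mul (by positivity), ← ENNReal.ofReal_add (by positivity) (by positivity),
      ← ENNReal.ofReal_add (by positivity) (by positivity)]
    refine ENNReal.ofReal_le_ofReal ?_
    have e1 : Y g i = (1 - h) * x i + Real.sqrt (2 * h) * g i := by
      simp [hY, f, drift_stdPot]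
    have e2 : Y (flip i g) i = (1 - h) * x i - Real.sqrt (2 * h) * g i := by
      simp [hY, f, drift_stdPot, flip_apply, sub_eq_add_neg]
    have e3 : ∀ j, j ≠ i → Y g j = Y (flip i g) j := fun j hj => by
      simp [hY, flip_apply, hj]
    have h1 := sq_mul_add_sq_mul_le (acceptProb_le_one f h x _)
      (acceptProb_le_one f h x _) (a := (1 - h) * x i) (b := Real.sqrt (2 * h) * g i)
      (fun hle => acceptProb_stdPot_anti hh x _ _ i (by rwa [e1, e2]) fun j hj => (e3 j hj).symm)
      (fun hle => acceptProb_stdPot_anti hh x _ _ i (by rwa [e1, e2]) e3)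
    have h2 : (Real.sqrt (2 * h) * g i) ^ 2 = 2 * h * g i ^ 2 := by
      rw [mul_pow, Real.sq_sqrt (by positivity)]
    -- The drift contracts towards `0` without overshooting, because `0 < h ≤ 1`.
    have h3 : ((1 - h) * x i) ^ 2 ≤ x i ^ 2 := by
      rw [mul_pow]
      exact mul_le_of_le_one_left (sq_nonneg _) (by nlinarith)
    rw [e1, e2]
    have h4 := mul_le_mul_of_nonneg_right h3 (add_nonneg hp0 hq0)
    linarith
  have hsum := lintegral_mono (μ := stdGaussian (Vec d)) hpt
  have hfm : Measurable (flip i : Vec d → Vec d) := (flip i).continuous.measurable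
  have hβ : Measurable fun g => ENNReal.ofReal (acceptProb f h x (Y (flip i g))) := hα.comp hfm
  have hαβ : Measurable fun g => ENNReal.ofReal (acceptProb f h x (Y g)) +
      ENNReal.ofReal (acceptProb f h x (Y (flip i g))) := hα.add hβ
  rw [lintegral_add_left hF, hflip (fun g => ENNReal.ofReal (Y g i ^ 2) *
    ENNReal.ofReal (acceptProb f h x (Y g))) hF,
    lintegral_add_left (hαβ.const_mul _),
    lintegral_const_mul _ hαβ, lintegral_add_left hα,
    hflip (fun g => ENNReal.ofReal (acceptProb f h x (Y g))) hα,
    lintegral_const_mul _ (by fun_prop), lintegral_sq_stdGaussian, mul_one, ← two_mul,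
    ← two_mul, show 4 * h = 2 * (2 * h) by ring, ENNReal.ofReal_mul (by norm_num),
    ENNReal.ofReal_ofNat, mul_left_comm, ← mul_add] at hsum
  exact (ENNReal.mul_le_mul_iff_right (by norm_num) (by norm_num)).1 hsum

theorem lintegral_sq_step_le {h : ℝ} (hh : 0 < h) (hh1 : h ≤ 1) (x : Vec d) (i : Fin d) :
    ∫⁻ y, ENNReal.ofReal (y i ^ 2) ∂(step (stdPot d) h x) ≤
      ENNReal.ofReal (x i ^ 2) + ENNReal.ofReal (2 * h) := by
  have hm : Measurable fun y : Vec d => ENNReal.ofReal (y i ^ 2) := by fun_prop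
  rw [step, lintegral_add_measure, lintegral_smul_measure, lintegral_dirac' _ hm,
    lintegral_withDensity_eq_lintegral_mul _
      (measurable_acceptProb_right measurable_stdPot h x) hm]
  simp only [Pi.mul_apply, smul_eq_mul]
  simp_rw [mul_comm (ENNReal.ofReal (acceptProb _ _ _ _))]
  calc _ ≤ ENNReal.ofReal (x i ^ 2) * acceptRate (stdPot d) h x + ENNReal.ofReal (2 * h) +
        (1 - acceptRate (stdPot d) h x) * ENNReal.ofReal (x i ^ 2) :=
        add_le_add (lintegral_sq_mul_acceptProb_le hh hh1 x i) le_rfl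
    _ = ENNReal.ofReal (x i ^ 2) *
        (acceptRate (stdPot d) h x + (1 - acceptRate (stdPot d) h x)) +
        ENNReal.ofReal (2 * h) := by ring
    _ = _ := by rw [add_tsub_cancel_of_le (acceptRate_le_one _ h x), mul_one]

theorem lintegral_sq_law_le {h : ℝ} (hh : 0 < h) (hh1 : h ≤ 1) (ρ : Measure (Vec d))
    [IsProbabilityMeasure ρ] (i : Fin d) (T : ℕ) :
    ∫⁻ y, ENNReal.ofReal (y i ^ 2) ∂(law (stdPot d) measurable_stdPot h ρ T) ≤
      ∫⁻ y, ENNReal.ofReal (y i ^ 2) ∂ρ + T * ENNReal.ofReal (2 * h) := by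
  induction T with
  | zero => simp [law]
  | succ T ih =>
    have := isProbabilityMeasure_law (stdPot d) measurable_stdPot h ρ T
    rw [law, Measure.lintegral_bind (Kernel.aemeasurable _) (by fun_prop)]
    calc _ ≤ ∫⁻ x, (ENNReal.ofReal (x i ^ 2) + ENNReal.ofReal (2 * h))
          ∂(law (stdPot d) measurable_stdPot h ρ T) :=
          lintegral_mono fun x => lintegral_sq_step_le hh hh1 x i
      _ = ∫⁻ y, ENNReal.ofReal (y i ^ 2) ∂(law (stdPot d) measurable_stdPot h ρ T) +
          ENNReal.ofReal (2 * h) := by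
          rw [lintegral_add_right _ measurable_const]; simp
      _ ≤ ∫⁻ y, ENNReal.ofReal (y i ^ 2) ∂ρ + T * ENNReal.ofReal (2 * h) +
          ENNReal.ofReal (2 * h) := by gcongr
      _ = _ := by push_cast; ring

/-- With step size `h`, MALA for the standard Gaussian needs `Ω(1 / h)` steps. -/
theorem exists_warm_stdPot (hd : 100 ≤ d) {h : ℝ} (hh : 0 < h) (hh1 : h ≤ 1) :
    ∃ ρ : Measure (Vec d), IsWarm (Real.exp d) (target (stdPot d)) ρ ∧
      ∀ T : ℕ, tvDist (target (stdPot d)) (law (stdPot d) measurable_stdPot h ρ T) ≤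
        Real.exp (-1) → 1 / 50 ≤ h * T := by
  set i : Fin d := ⟨0, by omega⟩
  set π := target (stdPot d)
  have hcoord : ∀ s : Set ℝ, MeasurableSet s → π {x | x i ∈ s} = target1 gaussPot s :=
    fun s hs => target_preimage (fun _ => contDiff_gaussPot.continuous.measurable) i hs
  have hcm : ∀ s : Set ℝ, MeasurableSet s → MeasurableSet {x : Vec d | x i ∈ s} := fun s hs =>
    (by fun_prop : Measurable fun x : Vec d => x i) hs
  set S : Set (Vec d) := {x | x i ∈ Set.Icc (-(1 / 10 : ℝ)) (1 / 10)} with hS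
  have hSm : MeasurableSet S := hcm _ measurableSet_Icc
  have hπS : ENNReal.ofReal (Real.exp (-d)) ≤ π S := by
    rw [hcoord _ measurableSet_Icc]
    refine (ENNReal.ofReal_le_ofReal ?_).trans (le_gaussPot_Icc (by norm_num))
    have h1 := Real.add_one_le_exp (-(1 / 10 : ℝ) ^ 2 / 2)
    have h2 := Real.add_one_le_exp (d : ℝ)
    have h3 : (100 : ℝ) ≤ d := by exact_mod_cast hd
    have h4 : Real.exp (-d) ≤ (100 : ℝ)⁻¹ := by
      rw [Real.exp_neg]; exact inv_anti₀ (by norm_num) (by linarith)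
    norm_num at h1 h4 ⊢
    linarith
  have hwarm := isWarm_cond π hπS
  refine ⟨π[|S], hwarm, fun T hT => ?_⟩
  have := hwarm.1
  set ρT := law (stdPot d) measurable_stdPot h (π[|S]) T
  have := isProbabilityMeasure_law (stdPot d) measurable_stdPot h (π[|S]) T
  -- The target has mass at least `3/5` outside `I`, whereas Markov's inequality gives the chain at
  -- most `4 (1/100 + 2hT)` there. Total variation at most `e⁻¹` then forces `h T ≥ 1/50`.
  set I : Set ℝ := Set.Icc (-(1 / 2)) (1 / 2)
  have hA : MeasurableSet {x : Vec d | x i ∈ Iᶜ} := hcm _ measurableSet_Icc.compl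
  have h1 := (sub_le_tvDist π ρT hA).trans hT
  have h2 : 3 / 5 ≤ π.real {x : Vec d | x i ∈ Iᶜ} := by
    rw [Measure.real, hcoord _ measurableSet_Icc.compl, ← Measure.real,
      probReal_compl_eq_one_sub measurableSet_Icc]
    have h3 := ENNReal.toReal_le_of_le_ofReal (by norm_num)
      (gaussPot_Icc_le (s := 1 / 2) (by norm_num))
    change (target1 gaussPot).real I ≤ _ at h3
    norm_num at h3 ⊢
    linarith
  have h0 : ∫⁻ y, ENNReal.ofReal (y i ^ 2) ∂(π[|S]) ≤ ENNReal.ofReal (1 / 100) := by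
    have hae : ∀ᵐ y ∂(π[|S]), ENNReal.ofReal (y i ^ 2) ≤ ENNReal.ofReal (1 / 100) := by
      refine (ae_iff.2 ?_)
      refine measure_mono_null (t := Sᶜ) (fun y hy hyS => hy ?_) (by rw [cond_apply hSm]; simp)
      refine ENNReal.ofReal_le_ofReal ?_
      have h5 : y i ^ 2 ≤ (1 / 10) ^ 2 := sq_le_sq' hyS.1 hyS.2
      norm_num at h5 ⊢
      exact h5
    refine (lintegral_mono_ae hae).trans ?_
    simp
  have h3 : ENNReal.ofReal (1 / 4) * ρT {x : Vec d | x i ∈ Iᶜ} ≤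
      ENNReal.ofReal (1 / 100 + T * (2 * h)) := by
    calc ENNReal.ofReal (1 / 4) * ρT {x : Vec d | x i ∈ Iᶜ}
        ≤ ENNReal.ofReal (1 / 4) * ρT {x | ENNReal.ofReal (1 / 4) ≤ ENNReal.ofReal (x i ^ 2)} := by
          refine mul_le_mul' le_rfl (measure_mono fun x hx => ?_)
          by_contra hlt
          refine hx ?_
          have h5 : ¬ (1 / 4 ≤ x i ^ 2) := fun h => hlt (ENNReal.ofReal_le_ofReal h)
          exact abs_le.1 (abs_le_of_sq_le_sq (by linarith) (by norm_num))
      _ ≤ ∫⁻ y, ENNReal.ofReal (y i ^ 2) ∂ρT := mul_meas_ge_le_lintegral (by fun_prop) _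
      _ ≤ _ := lintegral_sq_law_le hh hh1 _ i T
      _ ≤ ENNReal.ofReal (1 / 100) + T * ENNReal.ofReal (2 * h) := by gcongr
      _ = _ := by
          rw [ENNReal.ofReal_add (by norm_num) (by positivity),
            ENNReal.ofReal_mul (Nat.cast_nonneg T), ENNReal.ofReal_natCast]
  have h4 := ENNReal.toReal_le_of_le_ofReal (by positivity) h3
  rw [ENNReal.toReal_mul, ENNReal.toReal_ofReal (by norm_num)] at h4
  change 1 / 4 * ρT.real {x : Vec d | x i ∈ Iᶜ} ≤ _ at h4
  have h6 := Real.exp_neg_one_lt_d9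
  linarith

/-! ### Bottleneck boxes and large steps -/

/-- For a separable target, a box on which the acceptance probability factorizes into small factors
is a bottleneck. -/
theorem exists_warm_sep {φ : Fin d → ℝ → ℝ} (hφ : ∀ i, ContDiff ℝ 2 (φ i))
    [∀ i, IsProbabilityMeasure (target1 (φ i))] {S : Fin d → Set ℝ}
    (hS : ∀ i, MeasurableSet (S i)) {h : ℝ} {q b : Fin d → ℝ}
    (hq : ∀ i, ENNReal.ofReal (Real.exp (-q i)) ≤ target1 (φ i) (S i)) (hqd : ∑ i, q i ≤ d)
    (hb : ∀ i, ∀ a ∈ S i, ∫⁻ g, ENNReal.ofReal (Real.exp (logRatio (φ i) h a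
      (a - h * deriv (φ i) a + Real.sqrt (2 * h) * g))) ∂(gaussianReal 0 1) ≤
        ENNReal.ofReal (Real.exp (-b i)))
    (i₀ : Fin d) (hi₀ : target1 (φ i₀) (S i₀) ≤ ENNReal.ofReal (14 / 25)) :
    ∃ ρ : Measure (Vec d), IsWarm (Real.exp d) (target (sep φ)) ρ ∧
      ∀ (hf : Measurable (sep φ)) (T : ℕ), tvDist (target (sep φ)) (law (sep φ) hf h ρ T) ≤
        Real.exp (-1) → 1 / 20 ≤ T * Real.exp (-∑ i, b i) := by
  have hm : ∀ i, Measurable (φ i) := fun i => (hφ i).continuous.measurable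
  have := isProbabilityMeasure_target_sep hm
  have hmass : ENNReal.ofReal (Real.exp (-d)) ≤ target (sep φ) (box S) := by
    rw [target_box hm hS]
    calc ENNReal.ofReal (Real.exp (-d)) ≤ ENNReal.ofReal (Real.exp (∑ i, -q i)) := by
          rw [Finset.sum_neg_distrib]
          exact ENNReal.ofReal_le_ofReal (Real.exp_le_exp.2 (neg_le_neg hqd))
      _ = ∏ i, ENNReal.ofReal (Real.exp (-q i)) := by
          rw [Real.exp_sum, ENNReal.ofReal_prod_of_nonneg fun i _ => (Real.exp_pos _).le]
      _ ≤ _ := Finset.prod_le_prod' fun i _ => hq i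
  refine ⟨_, isWarm_cond _ hmass, fun hf T hT => ?_⟩
  have hrate : ∀ x ∈ box S, acceptRate (sep φ) h x ≤
      ENNReal.ofReal (Real.exp (-∑ i, b i)) := by
    intro x hx
    refine (acceptRate_sep_le hφ h x).trans ?_
    rw [← Finset.sum_neg_distrib, Real.exp_sum,
      ENNReal.ofReal_prod_of_nonneg fun i _ => (Real.exp_pos _).le]
    exact Finset.prod_le_prod' fun i _ => hb i _ (hx i)
  have hS0 : target (sep φ) (box S) ≠ 0 := fun h0 => by
    rw [h0, nonpos_iff_eq_zero, ENNReal.ofReal_eq_zero] at hmass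
    exact absurd hmass (not_le.2 (Real.exp_pos _))
  have hup : (target (sep φ)).real (box S) ≤ 14 / 25 := by
    refine ENNReal.toReal_le_of_le_ofReal (by norm_num) ?_
    calc target (sep φ) (box S) ≤ target (sep φ) {x | x i₀ ∈ S i₀} :=
          measure_mono fun x hx => hx i₀
      _ = target1 (φ i₀) (S i₀) := target_preimage hm i₀ (hS i₀)
      _ ≤ _ := hi₀
  have h1 := le_of_tvDist_cond_le (sep φ) hf h (measurableSet_box hS) hS0 hup
    (Real.exp_pos _).le hrate hT
  -- The constant `14/25` leaves `1 - 14/25 - e⁻¹ > 1/20`.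
  have h2 := Real.exp_neg_one_lt_d9
  linarith

/-- The bottleneck of a Gaussian coordinate. -/
def gaussBox : Set ℝ := Set.Icc (-(7 / 10)) (7 / 10)

/-- The half-width `7/10` meets three demands: its square is below the `1/2` of
`gaussPot_factor_le`, the mass stays below `14/25`, and the cost `9/10` per coordinate leaves `d /
10` of the warmness budget for the bump coordinates. -/
theorem le_gaussBox : ENNReal.ofReal (Real.exp (-(9 / 10))) ≤ target1 gaussPot gaussBox := by
  refine (ENNReal.ofReal_le_ofReal ?_).trans (le_gaussPot_Icc (by norm_num))
  have h1 := Real.add_one_le_exp (-(7 / 10 : ℝ) ^ 2 / 2)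
  have h2 := Real.quadratic_le_exp_of_nonneg (x := 3 / 10) (by norm_num)
  have h3 : (2.43 : ℝ) ≤ Real.exp (9 / 10) := by
    rw [show (9 / 10 : ℝ) = (3 : ℕ) * (3 / 10) by norm_num, Real.exp_nat_mul]
    calc (2.43 : ℝ) ≤ (1.345) ^ 3 := by norm_num
      _ ≤ _ := by gcongr; linarith
  rw [Real.exp_neg]
  have h4 : (Real.exp (9 / 10))⁻¹ ≤ (2.43)⁻¹ := inv_anti₀ (by norm_num) h3
  norm_num at h1 h4 ⊢
  linarith

theorem gaussBox_le : target1 gaussPot gaussBox ≤ ENNReal.ofReal (14 / 25) :=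
  (gaussPot_Icc_le (by norm_num)).trans_eq (by norm_num)

theorem gaussBox_factor_le {h a : ℝ} (hh : 0 < h) (ha : a ∈ gaussBox) :
    ∫⁻ g, ENNReal.ofReal (Real.exp (logRatio gaussPot h a
      (a - h * deriv gaussPot a + Real.sqrt (2 * h) * g))) ∂(gaussianReal 0 1) ≤
      ENNReal.ofReal (Real.exp (-(Real.log (1 + h ^ 2) / 4))) := by
  refine gaussPot_factor_le hh ?_
  have : a ^ 2 ≤ (7 / 10) ^ 2 := sq_le_sq' ha.1 ha.2
  norm_num at this ⊢
  linarith

theorem exists_warm_stdPot_of_large_step (hd : 0 < d) {h : ℝ} (hh : 0 < h) :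
    ∃ ρ : Measure (Vec d), IsWarm (Real.exp d) (target (stdPot d)) ρ ∧
      ∀ (hf : Measurable (stdPot d)) (T : ℕ),
        tvDist (target (stdPot d)) (law (stdPot d) hf h ρ T) ≤ Real.exp (-1) →
          1 / 20 ≤ T * Real.exp (-(d * (Real.log (1 + h ^ 2) / 4))) := by
  have := exists_warm_sep (φ := fun _ : Fin d => gaussPot) (S := fun _ => gaussBox) (h := h)
    (q := fun _ => 9 / 10) (b := fun _ => Real.log (1 + h ^ 2) / 4)
    (fun _ => contDiff_gaussPot) (fun _ => measurableSet_Icc) (fun _ => le_gaussBox)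
    (by simp; linarith [Nat.cast_nonneg (α := ℝ) d])
    (fun _ a ha => gaussBox_factor_le hh ha) ⟨0, hd⟩ gaussBox_le
  simpa [stdPot] using this

theorem sum_ite_val_lt {m : ℕ} (hm : m ≤ d) (c : ℝ) :
    ∑ i : Fin d, (if (i : ℕ) < m then c else 0) = m * c := by
  rw [Fin.sum_univ_eq_sum_range (fun i => if i < m then c else 0) d, ← Finset.sum_filter,
    show (Finset.range d).filter (· < m) = Finset.range m by ext; simp; omega]
  simp

/-! ### Intermediate steps: mixing bump and Gaussian coordinates -/

/-- The potential with `m` bump coordinates and Gaussian remaining coordinates. -/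
def mixedPot (d m : ℕ) (κ s : ℝ) (i : Fin d) : ℝ → ℝ :=
  if (i : ℕ) < m then bumpPot κ s else gaussPot

theorem hessianBetween_mixedPot {m : ℕ} {κ κ' s : ℝ} (hκ : 10 ≤ κ) (hκ' : κ ≤ κ') (hs : 0 < s) :
    HessianBetween κ' (sep (mixedPot d m κ s)) := by
  refine hessianBetween_sep (fun i => ?_) (fun i t => ?_) fun i t => ?_ <;>
    unfold mixedPot <;> split_ifs
  · exact contDiff_bumpPot κ s
  · exact contDiff_gaussPot
  · exact one_le_deriv_deriv_bumpPot hκ hs t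
  · exact (deriv_deriv_gaussPot t).ge
  · exact (deriv_deriv_bumpPot_le (by linarith) hs t).trans hκ'
  · rw [deriv_deriv_gaussPot]; linarith

theorem isProbabilityMeasure_mixedPot {m : ℕ} {κ s : ℝ} (hκ : 0 < κ) (hs : 0 < s) (i : Fin d) :
    IsProbabilityMeasure (target1 (mixedPot d m κ s i)) := by
  unfold mixedPot
  split_ifs
  · exact isProbabilityMeasure_bumpPot hκ hs
  · infer_instance

/-- The bump coordinates produce the rejection. The Gaussian ones are confined only so that the box
has mass bounded away from `1`; their acceptance factor is bounded by `1`. -/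
theorem exists_warm_mixedPot {m : ℕ} (hm : m < d) {κ s : ℝ} (hκ : 0 < κ) (hs : 0 < s)
    (hτ : κ * s ^ 2 ≤ 1) (hmd : m * Real.log d ≤ d / 10)
    (hw : (d : ℝ)⁻¹ ≤ bumpWidth / 8 * Real.sqrt (κ * s ^ 2)) :
    ∃ ρ : Measure (Vec d), IsWarm (Real.exp d) (target (sep (mixedPot d m κ s))) ρ ∧
      ∀ (hf : Measurable (sep (mixedPot d m κ s))) (T : ℕ),
        tvDist (target (sep (mixedPot d m κ s))) (law (sep (mixedPot d m κ s)) hf (s ^ 2) ρ T) ≤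
          Real.exp (-1) → 1 / 20 ≤ T * Real.exp (-(m * (tailProb / 20 * (κ * s ^ 2)))) := by
  have hd0 : (0 : ℝ) < d := by exact_mod_cast (Nat.zero_le m).trans_lt hm
  have hd1 : (1 : ℝ) ≤ d := by exact_mod_cast (Nat.zero_le m).trans_lt hm
  have := fun i : Fin d => isProbabilityMeasure_mixedPot (m := m) hκ hs i
  have hlog : 0 ≤ Real.log d := Real.log_nonneg hd1
  have key := exists_warm_sep (φ := mixedPot d m κ s)
    (S := fun i => if (i : ℕ) < m then Set.Icc (-(bumpWidth * s)) (bumpWidth * s) else gaussBox)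
    -- Every coordinate is charged `9/10`, and a bump coordinate `log d` more since its interval has
    -- mass at least `1/d`; the total is at most `9 d / 10 + m log d ≤ d`.
    (h := s ^ 2) (q := fun i => (if (i : ℕ) < m then Real.log d else 0) + 9 / 10)
    (b := fun i => if (i : ℕ) < m then tailProb / 20 * (κ * s ^ 2) else 0)
    (fun i => by
      unfold mixedPot
      split_ifs
      · exact contDiff_bumpPot κ s
      · exact contDiff_gaussPot)
    (fun i => by split_ifs <;> exact measurableSet_Icc)
    (fun i => by
      unfold mixedPot
      split_ifs
      · refine (ENNReal.ofReal_le_ofReal ?_).trans (le_bumpPot_Icc hκ hs hτ)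
        refine le_trans ?_ hw
        calc Real.exp (-(Real.log d + 9 / 10)) ≤ Real.exp (-Real.log d) :=
              Real.exp_le_exp.2 (by linarith)
          _ = (d : ℝ)⁻¹ := by rw [Real.exp_neg, Real.exp_log hd0]
      · rw [zero_add]; exact le_gaussBox)
    (by
      rw [Finset.sum_add_distrib, sum_ite_val_lt hm.le]
      simp
      linarith)
    (fun i a ha => by
      unfold mixedPot
      split_ifs with h
      · rw [if_pos h] at ha
        exact bumpPot_factor_le hκ hs hτ ha
      · rw [if_neg h] at ha
        refine (gaussBox_factor_le (by positivity) ha).trans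
          (ENNReal.ofReal_le_ofReal (Real.exp_le_exp.2 (neg_le_neg ?_)))
        have : 0 ≤ Real.log (1 + (s ^ 2) ^ 2) :=
          Real.log_nonneg (by linarith [sq_nonneg (s ^ 2)])
        positivity)
    -- The last coordinate is Gaussian because `m < d`.
    ⟨d - 1, by omega⟩ (by
      have h1 : ¬ (d - 1 < m) := by omega
      simp only [mixedPot, h1, if_false]
      exact gaussBox_le)
  simpa only [sum_ite_val_lt hm.le] using key

/-- The constant multiplying `log² d / (κ d)` in the threshold between small and large steps. -/
def stepThreshold : ℝ := 4000 / tailProb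

theorem le_stepThreshold : 4000 ≤ stepThreshold :=
  (le_div_iff₀ tailProb_pos).2 (by linarith [tailProb_le_one])

theorem eventually_dimension_bounds (K B : ℝ) :
    ∀ᶠ d : ℕ in Filter.atTop, B ≤ d ∧ 1 ≤ Real.log d ∧ K * Real.log d ^ 2 ≤ d := by
  have h1 : ∀ᶠ x : ℝ in Filter.atTop, B ≤ x ∧ 1 ≤ Real.log x ∧ K * Real.log x ^ 2 ≤ x := by
    have ho := (Real.isLittleO_pow_log_id_atTop (n := 2)).bound
      (show 0 < (|K| + 1)⁻¹ by positivity)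
    filter_upwards [ho, Filter.eventually_ge_atTop B,
      Real.tendsto_log_atTop.eventually_ge_atTop 1, Filter.eventually_ge_atTop 0]
      with x hx hB hl h0
    refine ⟨hB, hl, ?_⟩
    rw [Real.norm_of_nonneg (by positivity), id, Real.norm_of_nonneg h0,
      inv_mul_eq_div, le_div_iff₀ (by positivity)] at hx
    have := mul_le_mul_of_nonneg_right (le_abs_self K) (sq_nonneg (Real.log x))
    nlinarith [sq_nonneg (Real.log x)]
  exact tendsto_natCast_atTop_atTop.eventually h1

/-- This is where `κ ≤ C d⁴` enters: an acceptance rate of `D⁻⁵` beats the required `κ D` up to a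
constant. -/
theorem le_of_le_mul_inv_pow {C κ D ℓ T : ℝ} (hC : 0 < C) (hD : 0 < D) (hℓ : 1 ≤ ℓ)
    (hκ0 : 0 ≤ κ) (hκ : κ ≤ C * D ^ 4) (hT : 1 / 20 ≤ T * (D ^ 5)⁻¹) :
    1 / (20 * C) * (κ * D / ℓ ^ 2) ≤ T := by
  have h1 : D ^ 5 / 20 ≤ T := by
    rw [← div_eq_mul_inv, le_div_iff₀ (by positivity)] at hT
    linarith
  have h2 : κ * D / ℓ ^ 2 ≤ κ * D := div_le_self (by positivity) (one_le_pow₀ hℓ)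
  calc 1 / (20 * C) * (κ * D / ℓ ^ 2) ≤ 1 / (20 * C) * (C * D ^ 4 * D) := by
        gcongr
        exact h2.trans (by gcongr)
    _ = D ^ 5 / 20 := by field_simp
    _ ≤ T := h1

theorem exp_neg_five_mul_log {D x : ℝ} (hD : 0 < D) (hx : 5 * Real.log D ≤ x) :
    Real.exp (-x) ≤ (D ^ 5)⁻¹ := by
  calc Real.exp (-x) ≤ Real.exp (-(5 * Real.log D)) := Real.exp_le_exp.2 (neg_le_neg hx)
    _ = (D ^ 5)⁻¹ := by
      rw [Real.exp_neg, show (5 : ℝ) * Real.log D = (5 : ℕ) * Real.log D by norm_num,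
        Real.exp_nat_mul, Real.exp_log hD]

theorem exists_warm_of_intermediate_step {κ h : ℝ}
    (hdw : 64 / bumpWidth ^ 2 ≤ d) (hℓ : 1 ≤ Real.log d)
    (hdℓ : stepThreshold * Real.log d ^ 2 ≤ d) (hκ : 10 ≤ κ) (hh : 0 < h) (hh1 : h ≤ 1 / 10)
    (hκh : stepThreshold * Real.log d ^ 2 / (κ * d) ≤ h) :
    ∃ (f : Vec d → ℝ) (hf : HessianBetween κ f) (ρ : Measure (Vec d)),
      IsProbabilityMeasure (target f) ∧ IsWarm (Real.exp d) (target f) ρ ∧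
      ∀ T : ℕ, tvDist (target f) (law f hf.measurable h ρ T) ≤ Real.exp (-1) →
        1 / 20 ≤ T * ((d : ℝ) ^ 5)⁻¹ := by
  have hw0 := bumpWidth_pos
  have hp0 := tailProb_pos
  have hA := le_stepThreshold
  have hd : (0 : ℝ) < d := lt_of_lt_of_le (by positivity) hdw
  set ℓ := Real.log d
  have hℓ2 : ℓ ≤ ℓ ^ 2 := by nlinarith
  have hdℓ' : 4000 * ℓ ^ 2 ≤ d := le_trans (by gcongr) hdℓ
  -- Capping the curvature at `1 / h` keeps `τ = κ' h ≤ 1`; `h ≤ 1/10` keeps the cap at least `10`,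
  -- as strong convexity of the bump requires.
  set κ' := min κ (1 / h)
  have hκ' : 10 ≤ κ' := le_min hκ ((le_div_iff₀ hh).2 (by linarith))
  set s := Real.sqrt h
  have hs : 0 < s := Real.sqrt_pos.2 hh
  have hs2 : s ^ 2 = h := Real.sq_sqrt hh.le
  have hτ1 : κ' * s ^ 2 ≤ 1 := by
    rw [hs2]
    calc κ' * h ≤ 1 / h * h := by gcongr; exact min_le_right _ _
      _ = 1 := by field_simp
  have hτ0 : stepThreshold * ℓ ^ 2 / d ≤ κ' * s ^ 2 := by
    rw [hs2]
    rcases min_choice κ (1 / h) with hc | hc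
    · rw [show κ' = κ from hc]
      calc stepThreshold * ℓ ^ 2 / d = κ * (stepThreshold * ℓ ^ 2 / (κ * d)) := by field_simp
        _ ≤ κ * h := by gcongr
    · rw [show κ' = 1 / h from hc, div_mul_cancel₀ _ hh.ne']
      exact (div_le_one hd).2 hdℓ
  -- As many bump coordinates as the budget `m log d ≤ d / 10` allows, up to a constant.
  set m := ⌊(d : ℝ) / (20 * ℓ)⌋₊
  have hm1 : (m : ℝ) ≤ d / (20 * ℓ) := Nat.floor_le (by positivity)
  have hm1' : m * (20 * ℓ) ≤ d := (le_div_iff₀ (by positivity)).1 hm1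
  have hm2 : (d : ℝ) / (40 * ℓ) ≤ m := by
    have h1 := Nat.lt_floor_add_one ((d : ℝ) / (20 * ℓ))
    have h2 : 1 ≤ (d : ℝ) / (40 * ℓ) := (le_div_iff₀ (by positivity)).2 (by nlinarith)
    have h3 : (d : ℝ) / (20 * ℓ) = d / (40 * ℓ) + d / (40 * ℓ) := by field_simp; norm_num
    change _ < (m : ℝ) + 1 at h1
    linarith
  have hm : m < d := by
    have : (m : ℝ) < d := by
      have hm0 : (0 : ℝ) ≤ m := Nat.cast_nonneg m
      nlinarith
    exact_mod_cast this
  have hmass : (d : ℝ)⁻¹ ≤ bumpWidth / 8 * Real.sqrt (κ' * s ^ 2) := by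
    have h1 : (1 : ℝ) / d ≤ κ' * s ^ 2 := by
      refine le_trans ?_ hτ0
      gcongr
      nlinarith
    have h2 : 8 / (bumpWidth * d) ≤ Real.sqrt (κ' * s ^ 2) := by
      refine Real.le_sqrt_of_sq_le (le_trans ?_ h1)
      rw [div_pow, div_le_div_iff₀ (by positivity) hd]
      rw [div_le_iff₀ (by positivity)] at hdw
      nlinarith
    calc (d : ℝ)⁻¹ = bumpWidth / 8 * (8 / (bumpWidth * d)) := by field_simp
      _ ≤ _ := by gcongr
  obtain ⟨ρ, hρ, hT⟩ := exists_warm_mixedPot hm (by linarith : 0 < κ') hs hτ1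
    (by change m * ℓ ≤ d / 10; nlinarith) hmass
  have hprob := fun i : Fin d =>
    isProbabilityMeasure_mixedPot (m := m) (by linarith : 0 < κ') hs i
  have hhess : HessianBetween κ (sep (mixedPot d m κ' s)) :=
    hessianBetween_mixedPot hκ' (min_le_left _ _) hs
  have hφ : ∀ i, Measurable (mixedPot d m κ' s i) := fun i => by
    unfold mixedPot
    split_ifs
    · exact (contDiff_bumpPot κ' s).continuous.measurable
    · exact contDiff_gaussPot.continuous.measurable
  refine ⟨_, hhess, ρ, isProbabilityMeasure_target_sep hφ, hρ, fun T hTV => ?_⟩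
  have h1 := hT hhess.measurable T (by rwa [hs2])
  refine h1.trans (mul_le_mul_of_nonneg_left (exp_neg_five_mul_log hd ?_) (Nat.cast_nonneg T))
  -- The constant `4000 = 5 * 40 * 20` in `stepThreshold` is chosen for this identity.
  calc 5 * Real.log d = d / (40 * ℓ) * (tailProb / 20 * (stepThreshold * ℓ ^ 2 / d)) := by
        unfold stepThreshold
        change 5 * ℓ = _
        field_simp
        norm_num
    _ ≤ _ := by gcongr

end MALA

end

/-! ### Combining the three regimes -/

theorem theorem3 (C : ℝ) :
    ∃ c : ℝ, 0 < c ∧ ∃ d₀ : ℕ, ∀ d : ℕ, d₀ ≤ d →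
      ∀ κ : ℝ, 10 ≤ κ → κ ≤ C * (d : ℝ) ^ 4 →
        ∀ h : ℝ, 0 < h →
          ∃ (f : MALA.Vec d → ℝ) (hf : MALA.HessianBetween κ f) (ρ : Measure (MALA.Vec d)),
            IsProbabilityMeasure (MALA.target f) ∧
            MALA.IsWarm (Real.exp d) (MALA.target f) ρ ∧
            ∀ T : ℕ,
              MALA.tvDist (MALA.target f) (MALA.law f hf.measurable h ρ T) ≤ Real.exp (-1) →
                c * (κ * d / Real.log d ^ 2) ≤ T := by
  have hA := MALA.le_stepThreshold
  have hlog : 0 < Real.log (1 + (1 / 10) ^ 2) := Real.log_pos (by norm_num)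
  set A := MALA.stepThreshold
  have hC : 0 < |C| + 1 := by positivity
  obtain ⟨d₀, hd₀⟩ := Filter.eventually_atTop.1 (MALA.eventually_dimension_bounds
    (A + 20 / Real.log (1 + (1 / 10) ^ 2)) (100 + 64 / MALA.bumpWidth ^ 2))
  -- The first constant serves the small-step regime, the second the two regimes with acceptance
  -- rate at most `d⁻⁵`.
  refine ⟨min (1 / (50 * A)) (1 / (20 * (|C| + 1))), by positivity, d₀,
    fun d hd κ hκ hκC h hh => ?_⟩
  obtain ⟨hB, hℓ, hK⟩ := hd₀ d hd
  have hw : 0 < 64 / MALA.bumpWidth ^ 2 := by have := MALA.bumpWidth_pos; positivity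
  have hd100 : (100 : ℝ) ≤ d := by linarith
  have hd0 : (0 : ℝ) < d := by linarith
  have hκ0 : 0 < κ := by linarith
  have hK1 : A * Real.log d ^ 2 ≤ d := by
    refine le_trans ?_ hK
    gcongr
    exact le_add_of_nonneg_right (by positivity)
  have hK2 : 20 / Real.log (1 + (1 / 10) ^ 2) * Real.log d ^ 2 ≤ d := by
    refine le_trans ?_ hK
    gcongr
    linarith
  have hκC' : κ ≤ (|C| + 1) * (d : ℝ) ^ 4 := hκC.trans (by
    gcongr
    linarith [le_abs_self C])
  have hfin : ∀ T : ℕ, 1 / 20 ≤ T * ((d : ℝ) ^ 5)⁻¹ →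
      min (1 / (50 * A)) (1 / (20 * (|C| + 1))) * (κ * d / Real.log d ^ 2) ≤ T := fun T hT =>
    (mul_le_mul_of_nonneg_right (min_le_right _ _) (by positivity)).trans
      (MALA.le_of_le_mul_inv_pow hC hd0 hℓ hκ0.le hκC' hT)
  rcases le_total h (A * Real.log d ^ 2 / (κ * d)) with hsmall | hlarge
  · have hh1 : h ≤ 1 := by
      refine hsmall.trans ((div_le_one (by positivity)).2 (hK1.trans ?_))
      nlinarith
    obtain ⟨ρ, hρ, hT⟩ := MALA.exists_warm_stdPot (d := d) (by exact_mod_cast hd100) hh hh1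
    refine ⟨MALA.stdPot d, MALA.hessianBetween_stdPot (by linarith), ρ, inferInstance, hρ,
      fun T hTV => ?_⟩
    have h1 := hT T hTV
    have h2 : 1 / 50 ≤ A * Real.log d ^ 2 / (κ * d) * T := h1.trans (by gcongr)
    calc _ ≤ 1 / (50 * A) * (κ * d / Real.log d ^ 2) :=
          mul_le_mul_of_nonneg_right (min_le_left _ _) (by positivity)
      _ = 1 / 50 * (κ * d / (A * Real.log d ^ 2)) := by field_simp
      _ ≤ A * Real.log d ^ 2 / (κ * d) * T * (κ * d / (A * Real.log d ^ 2)) := by gcongr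
      _ = T := by field_simp
  rcases le_total h (1 / 10) with hh1 | hh1
  · obtain ⟨f, hf, ρ, h1, h2, h3⟩ := MALA.exists_warm_of_intermediate_step (d := d)
      (by linarith) hℓ hK1 hκ hh hh1 hlarge
    exact ⟨f, hf, ρ, h1, h2, fun T hTV => hfin T (h3 T hTV)⟩
  · obtain ⟨ρ, hρ, hT⟩ := MALA.exists_warm_stdPot_of_large_step (d := d)
      (by exact_mod_cast hd0) hh
    refine ⟨MALA.stdPot d, MALA.hessianBetween_stdPot (by linarith), ρ, inferInstance, hρ,
      fun T hTV => hfin T ?_⟩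
    refine (hT _ T hTV).trans
      (mul_le_mul_of_nonneg_left (MALA.exp_neg_five_mul_log hd0 ?_) (Nat.cast_nonneg T))
    have h1 : Real.log (1 + (1 / 10) ^ 2) ≤ Real.log (1 + h ^ 2) :=
      Real.log_le_log (by norm_num) (by gcongr)
    -- The constant `20 / log (1 + 1/100)` in the choice of `d₀` makes `d * log (1 + h²) / 4` at
    -- least `5 log d`.
    rw [div_mul_eq_mul_div, div_le_iff₀ hlog] at hK2
    have h2 : Real.log d ≤ Real.log d ^ 2 := by nlinarith
    have h3 : d * Real.log (1 + (1 / 10) ^ 2) ≤ d * Real.log (1 + h ^ 2) := by gcongr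
    linarith
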